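/- Let $\mathbb{T}^2=\mathbb{R}^2/(2\pi\mathbb{Z})^2$ be the flat torus, let $dx$ be its volume measure normalized to have total mass $1$, and let $\sigma(\Delta)\subset\mathbb{Z}_{\ge 0}$ be the set of integers that are a sum of two squares (equivalently, the set of eigenvalues of $-\Delta$ on $\mathbb{T}^2$, without multiplicity). Let $\Sigma\subset\mathbb{T}^2$ be a smooth closed embedded and oriented curve (a compact one-dimensional embedded submanifold without boundary) with nowhere vanishing curvature, and let $\sigma$ be the induced arc length measure on $\Sigma$. Then there exists a subset $S\subset\sigma(\Delta)$ of density one, that is, $$\lim_{N\to\infty}\frac{|\{E\in S: E\le N\}|}{|\{E\in\sigma(\Delta): E\le N\}|}=1,$$ such that the following holds. For every sequence $\lambda_n\to+\infty$ with $\lambda_n^2\in S$ for all $n$, and every sequence of functions $\psi_n:\mathbb{T}^2\to\mathbb{C}$ with $$\Delta\psi_n=-\lambda_n^2\psi_n,\qquad \int_{\mathbb{T}^2}|\psi_n|^2\,dx=1,$$ one has $$\forall a\in\mathcal{C}^0(\mathbb{T}^2),\qquad \lim_{n\to\infty}\int_{\Sigma}a\,|\psi_n|^2\,d\sigma=\int_{\Sigma}a\,d\sigma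 .$$ -/

import Mathlib

open MeasureTheory Filter Topology
open scoped ContDiff Laplacian

noncomputable section

namespace TorusQUE

/-- The Euclidean plane `ℝ²`. -/
abbrev Plane : Type := EuclideanSpace ℝ (Fin 2)

instance factTwoPiPos : Fact (0 < 2 * Real.pi) := ⟨Real.two_pi_pos⟩

/-- The flat torus `𝕋² = ℝ² / (2πℤ)²`. -/
abbrev Torus : Type := Fin 2 → AddCircle (2 * Real.pi)

/-- The covering map `ℝ² → 𝕋²`. -/
def proj (x : Plane) : Torus := fun i => ((x i : ℝ) : AddCircle (2 * Real.pi))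

/-- The normalized volume measure `dx` on `𝕋²`, of total mass `1`. -/
def normalizedVolume : Measure Torus :=
  Measure.pi fun _ : Fin 2 => (AddCircle.haarAddCircle : Measure (AddCircle (2 * Real.pi)))

/-- `ψ` is an `L²`-normalized solution of `Δψ = -lam² ψ` on the flat torus. Differentiability and
the Laplacian are those of the lift of `ψ` to `ℝ²`, since the covering map is a local isometry. -/
structure IsNormalizedEigenfunction (ψ : Torus → ℂ) (lam : ℝ) : Prop where
  contDiff : ContDiff ℝ 2 (fun x : Plane => ψ (proj x))
  eigen : ∀ x : Plane, (Δ (fun y : Plane => ψ (proj y))) x = -((lam : ℂ) ^ 2) * ψ (proj x)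
  normalized : ∫ x, ‖ψ x‖ ^ 2 ∂normalizedVolume = 1

/-- A smooth closed embedded curve in `𝕋²`, that is, a compact embedded one-dimensional smooth
submanifold without boundary: it has finitely many connected components, and each of them is
a circle, traversed once by a regular periodic smooth parametrization (given by a lift to `ℝ²`;
it also orients the component). Different components are disjoint. -/
structure ClosedCurve where
  /-- the number of connected components -/
  numComponents : ℕ
  /-- the period of the parametrization of each component -/
  period : Fin numComponents → ℝ
  period_pos : ∀ i, 0 < period i
  /-- lifts to `ℝ²` of the parametrizations of the components -/
  param : Fin numComponents → ℝ → Plane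
  smooth : ∀ i, ContDiff ℝ ∞ (param i)
  regular : ∀ i t, deriv (param i) t ≠ 0
  periodic : ∀ i t, proj (param i (t + period i)) = proj (param i t)
  embedded : ∀ i j s t, proj (param i s) = proj (param j t) →
    i = j ∧ ∃ m : ℤ, t = s + m * period i

namespace ClosedCurve

/-- The signed (geodesic) curvature `(x' y'' - y' x'') / |γ'|³` of the curve. -/
def curvature (C : ClosedCurve) (i : Fin C.numComponents) (t : ℝ) : ℝ :=
  (deriv (C.param i) t 0 * deriv (deriv (C.param i)) t 1
      - deriv (C.param i) t 1 * deriv (deriv (C.param i)) t 0) / ‖deriv (C.param i) t‖ ^ 3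

/-- The induced Riemannian (arc length) measure `σ` of the curve, as a measure on `𝕋²`. -/
def arcLength (C : ClosedCurve) : Measure Torus :=
  ∑ i, Measure.map (fun t => proj (C.param i t))
    ((volume.restrict (Set.Ioc 0 (C.period i))).withDensity
      fun t => ENNReal.ofReal ‖deriv (C.param i) t‖)

end ClosedCurve

/-- `σ(Δ)`: the set of integers that are a sum of two squares, which are the eigenvalues of `-Δ`
on `𝕋²`, listed without multiplicity. -/
def laplaceSpectrum : Set ℕ := {E | ∃ k l : ℤ, (E : ℤ) = k ^ 2 + l ^ 2}

/-- `S` is a subset of `A` of density one in `A`: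
`|{E ∈ S : E ≤ N}| / |{E ∈ A : E ≤ N}| → 1` as `N → ∞`. -/
def IsDensityOneSubset (S A : Set ℕ) : Prop :=
  S ⊆ A ∧ Tendsto (fun N : ℕ => ((S ∩ Set.Iic N).ncard : ℝ) / ((A ∩ Set.Iic N).ncard : ℝ))
    atTop (𝓝 1)

end TorusQUE

end

noncomputable section

namespace TorusQUE

/-! An eigenfunction `u` with eigenvalue `E` is a trigonometric polynomial whose frequencies are the
integer points of the circle of radius `√E` (`IsNormalizedEigenfunction.expansion`). With
coefficients `c k`, testing `|u|² σ` against the character of frequency `j` gives the sum over `k`,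
`l` of `c k * conj (c l)` times the Fourier coefficient of `σ` at `k - l + j`. Since the `|c k|²`
sum to `1`, the diagonal is exactly the Fourier coefficient of `σ` at `j`. By Cauchy-Schwarz the
rest is at most the number of points on the circle times the largest off-diagonal Fourier
coefficient (`norm_integral_character_sub_le`).

Two facts make this small. Nonvanishing curvature forces the Fourier coefficient of `σ` at `m` to be
`O(|m|^(-1/3))` (`ClosedCurve.exists_fourier_decay`); the classical exponent `1/2` is not needed.
For most `E` the circle has at most `E^(1/32)` points, and any two of them differ by more than
`E^(1/4)` in some coordinate (`goodSpectrum`). The off-diagonal part is then `O(E^(1/32 - 1/12))`,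
which tends to `0`. Characters span a dense subspace and the masses stay bounded, so convergence
extends to all continuous test functions.

That most `E` are good is a matter of counting. Pairs of points on a common circle solve `u v = w
z`, whose solutions are parametrized by a gcd; this bounds the close pairs (`card_closePairs_le`)
and also the second moment of the number of points (`sum_card_sq_le`). Chebyshev then removes the
crowded circles, leaving `O(N^(31/32) log N)` exceptions. The same second moment and Cauchy-Schwarz
show that there are at least a constant times `N / log N` sums of two squares up to `N`
(`le_card_laplaceSpectrum`), so Landau's asymptotic is not required. -/

/-! ### Oscillatory integrals over curved arcs -/

/-- The set where a function `F` is small contributes little, if `F` and its derivative `F1` are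
never small together. -/
theorem integral_cutoff_le {T K c L D : ℝ} {F F1 F2 : ℝ → ℝ} (hT : 0 ≤ T)
    (hD : 0 < D)
    (hF : ∀ t, HasDerivAt F (F1 t) t) (hF1 : ∀ t, HasDerivAt F1 (F2 t) t) (hF2 : Continuous F2)
    (bF1 : ∀ t ∈ Set.Icc 0 T, |F1 t| ≤ K * L) (bF2 : ∀ t ∈ Set.Icc 0 T, |F2 t| ≤ K * L)
    (low : ∀ t ∈ Set.Icc 0 T, (c * L) ^ 2 ≤ F t ^ 2 + F1 t ^ 2) :
    (c * L) ^ 2 * ∫ t in (0 : ℝ)..T, D ^ 2 / (F t ^ 2 + D ^ 2) ≤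
      D ^ 2 * T + D * (K * L) * (4 + 2 * T) := by
  have cF : Continuous F := continuous_iff_continuousAt.2 fun t => (hF t).continuousAt
  have cF1 : Continuous F1 := continuous_iff_continuousAt.2 fun t => (hF1 t).continuousAt
  have hpos : ∀ t, 0 < F t ^ 2 + D ^ 2 := fun t => by positivity
  have hne : ∀ t, F t ^ 2 + D ^ 2 ≠ 0 := fun t => (hpos t).ne'
  have c1 : Continuous fun t => D ^ 2 / (F t ^ 2 + D ^ 2) := by fun_prop (disch := exact hne _)
  have c2 : Continuous fun t => F1 t * (D * F1 t / (F t ^ 2 + D ^ 2)) := by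
    fun_prop (disch := exact hne _)
  have hat : ∀ t, HasDerivAt (fun t => Real.arctan (F t / D)) (D * F1 t / (F t ^ 2 + D ^ 2)) t := by
    intro t
    convert ((hF t).div_const D).arctan using 1
    have := hne t
    field_simp
    ring
  have hatb : ∀ s, |Real.arctan s| ≤ 2 := fun s => by
    have h1 := Real.neg_pi_div_two_lt_arctan s
    have h2 := Real.arctan_lt_pi_div_two s
    have h3 := Real.pi_lt_four
    rw [abs_le]; constructor <;> linarith
  -- `F1² D / (F² + D²)` is `F1` times the derivative of `arctan (F / D)`. Moving the derivative
  -- onto `F1` leaves only the bounded arctangent, so there is no loss in `1 / D` and no need to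
  -- count the zeros of `F`.
  have ibp := intervalIntegral.integral_mul_deriv_eq_deriv_mul (a := 0) (b := T)
    (u := F1) (u' := F2) (v := fun t => Real.arctan (F t / D))
    (v' := fun t => D * F1 t / (F t ^ 2 + D ^ 2)) (fun t _ => hF1 t) (fun t _ => hat t)
    (hF2.intervalIntegrable _ _)
    ((by fun_prop (disch := exact hne _) : Continuous fun t => D * F1 t / (F t ^ 2 + D ^ 2)).intervalIntegrable _ _)
  have b0 : |F1 0| ≤ K * L := bF1 0 ⟨le_rfl, hT⟩
  have bT : |F1 T| ≤ K * L := bF1 T ⟨hT, le_rfl⟩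
  have hKL : 0 ≤ K * L := (abs_nonneg _).trans b0
  have e0 : |F1 0 * Real.arctan (F 0 / D)| ≤ K * L * 2 := by
    rw [abs_mul]; exact mul_le_mul b0 (hatb _) (abs_nonneg _) hKL
  have eT : |F1 T * Real.arctan (F T / D)| ≤ K * L * 2 := by
    rw [abs_mul]; exact mul_le_mul bT (hatb _) (abs_nonneg _) hKL
  have eI : |∫ t in (0 : ℝ)..T, F2 t * Real.arctan (F t / D)| ≤ K * L * 2 * T := by
    have := intervalIntegral.norm_integral_le_of_norm_le_const (a := 0) (b := T) (C := K * L * 2)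
      (f := fun t => F2 t * Real.arctan (F t / D)) (fun t ht => by
        rw [Set.uIoc_of_le hT] at ht
        rw [Real.norm_eq_abs, abs_mul]
        exact mul_le_mul (bF2 t ⟨ht.1.le, ht.2⟩) (hatb _) (abs_nonneg _) hKL)
    simpa [abs_of_nonneg hT] using this
  have key : ∫ t in (0 : ℝ)..T, F1 t * (D * F1 t / (F t ^ 2 + D ^ 2)) ≤ K * L * (4 + 2 * T) := by
    rw [ibp]
    have := abs_le.1 e0; have := abs_le.1 eT; have := abs_le.1 eI
    linarith
  calc (c * L) ^ 2 * ∫ t in (0 : ℝ)..T, D ^ 2 / (F t ^ 2 + D ^ 2)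
      = ∫ t in (0 : ℝ)..T, (c * L) ^ 2 * (D ^ 2 / (F t ^ 2 + D ^ 2)) := by
        rw [intervalIntegral.integral_const_mul]
    _ ≤ ∫ t in (0 : ℝ)..T, (D ^ 2 + D * (F1 t * (D * F1 t / (F t ^ 2 + D ^ 2)))) := by
        apply intervalIntegral.integral_mono_on hT
        · exact (continuous_const.mul c1).intervalIntegrable _ _
        · exact (continuous_const.add (continuous_const.mul c2)).intervalIntegrable _ _
        intro t ht
        -- The lower bound enters by multiplying the cutoff by `F² + D² + F1²`, which is at least
        -- `(c L)²`.
        have e : D ^ 2 + D * (F1 t * (D * F1 t / (F t ^ 2 + D ^ 2)))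
            = (F t ^ 2 + D ^ 2 + F1 t ^ 2) * (D ^ 2 / (F t ^ 2 + D ^ 2)) := by
          have := hne t
          field_simp
        rw [e]
        apply mul_le_mul_of_nonneg_right _ (by positivity)
        have := low t ht
        nlinarith [sq_nonneg D]
    _ = D ^ 2 * T + D * ∫ t in (0 : ℝ)..T, F1 t * (D * F1 t / (F t ^ 2 + D ^ 2)) := by
        have i2 : IntervalIntegrable (fun t => D * (F1 t * (D * F1 t / (F t ^ 2 + D ^ 2)))) volume 0 T :=
          (continuous_const.mul c2).intervalIntegrable _ _
        rw [intervalIntegral.integral_add (continuous_const.intervalIntegrable _ _) i2,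
          intervalIntegral.integral_const_mul, intervalIntegral.integral_const]
        simp [mul_comm]
    _ ≤ D ^ 2 * T + D * (K * L) * (4 + 2 * T) := by
        have := mul_le_mul_of_nonneg_left key hD.le
        linarith

/-- The part of an oscillatory integral where the derivative `F` of the phase is large. -/
theorem norm_integral_nonstationary_le {T K L D : ℝ} {φ F F1 w w1 : ℝ → ℝ} (hT : 0 ≤ T)
    (hD : 0 < D) (hφ : ∀ t, HasDerivAt φ (F t) t)
    (hF : ∀ t, HasDerivAt F (F1 t) t) (hF1 : Continuous F1)
    (hw : ∀ t, HasDerivAt w (w1 t) t) (hw1 : Continuous w1)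
    (bF1 : ∀ t ∈ Set.Icc 0 T, |F1 t| ≤ K * L)
    (bw : ∀ t ∈ Set.Icc 0 T, |w t| ≤ K) (bw1 : ∀ t ∈ Set.Icc 0 T, |w1 t| ≤ K) :
    ‖∫ t in (0 : ℝ)..T, (w t * (F t ^ 2 / (F t ^ 2 + D ^ 2)) : ℝ) * Complex.exp (φ t * Complex.I)‖ ≤
      2 * (K / D) + (K / D + K * (K * L) / D ^ 2) * T := by
  have cF : Continuous F := continuous_iff_continuousAt.2 fun t => (hF t).continuousAt
  have cw : Continuous w := continuous_iff_continuousAt.2 fun t => (hw t).continuousAt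
  have cφ : Continuous φ := continuous_iff_continuousAt.2 fun t => (hφ t).continuousAt
  have hpos : ∀ t, 0 < F t ^ 2 + D ^ 2 := fun t => by positivity
  have hne : ∀ t, F t ^ 2 + D ^ 2 ≠ 0 := fun t => (hpos t).ne'
  -- `G` is the damped amplitude divided by the phase derivative; the regularized quotient `F / (F²
  -- + D²)` stays bounded by `1 / D` even at the zeros of `F`.
  set G : ℝ → ℝ := fun t => w t * (F t / (F t ^ 2 + D ^ 2)) with hG
  set G1 : ℝ → ℝ := fun t => w1 t * (F t / (F t ^ 2 + D ^ 2)) +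
    w t * (F1 t * ((D ^ 2 - F t ^ 2) / (F t ^ 2 + D ^ 2) ^ 2)) with hG1
  have dG : ∀ t, HasDerivAt G (G1 t) t := by
    intro t
    have h2 : HasDerivAt (fun t => F t ^ 2 + D ^ 2) (2 * F t * F1 t) t := by
      simpa using ((hF t).pow 2).add_const (D ^ 2)
    refine ((hw t).mul ((hF t).div h2 (hne t))).congr_deriv ?_
    have := hne t
    simp only [hG1, Pi.div_apply]
    field_simp
    ring
  have cG1 : Continuous G1 := by
    have d1 : Continuous fun t => F t / (F t ^ 2 + D ^ 2) := by fun_prop (disch := exact hne _)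
    have d2 : Continuous fun t => (D ^ 2 - F t ^ 2) / (F t ^ 2 + D ^ 2) ^ 2 :=
      Continuous.div (by fun_prop) (by fun_prop) fun t => pow_ne_zero _ (hne t)
    exact (hw1.mul d1).add (cw.mul (hF1.mul d2))
  have frac : ∀ t, |F t / (F t ^ 2 + D ^ 2)| ≤ 1 / D := by
    intro t
    rw [abs_div, abs_of_pos (hpos t), div_le_div_iff₀ (hpos t) hD, ← sq_abs (F t)]
    nlinarith [sq_nonneg (|F t| - D), abs_nonneg (F t), sq_nonneg (|F t|), sq_nonneg D]
  have frac2 : ∀ t, |(D ^ 2 - F t ^ 2) / (F t ^ 2 + D ^ 2) ^ 2| ≤ 1 / D ^ 2 := by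
    intro t
    rw [abs_div, abs_of_pos (pow_pos (hpos t) 2), div_le_div_iff₀ (pow_pos (hpos t) 2) (by positivity)]
    have h1 : |D ^ 2 - F t ^ 2| ≤ F t ^ 2 + D ^ 2 := by
      rw [abs_le]; constructor <;> nlinarith [sq_nonneg D, sq_nonneg (F t)]
    have h2 : D ^ 2 ≤ F t ^ 2 + D ^ 2 := by nlinarith [sq_nonneg (F t)]
    calc _ ≤ (F t ^ 2 + D ^ 2) * (F t ^ 2 + D ^ 2) := mul_le_mul h1 h2 (by positivity) (hpos t).le
      _ = _ := by ring
  have hK : 0 ≤ K := (abs_nonneg _).trans (bw 0 ⟨le_rfl, hT⟩)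
  have hKL : 0 ≤ K * L := (abs_nonneg _).trans (bF1 0 ⟨le_rfl, hT⟩)
  have bG : ∀ t ∈ Set.Icc 0 T, |G t| ≤ K / D := by
    intro t ht
    rw [hG, div_eq_mul_one_div K, abs_mul]
    exact mul_le_mul (bw t ht) (frac t) (abs_nonneg _) hK
  have bG1 : ∀ t ∈ Set.Icc 0 T, |G1 t| ≤ K / D + K * (K * L) / D ^ 2 := by
    intro t ht
    refine (abs_add_le _ _).trans (add_le_add ?_ ?_)
    · rw [div_eq_mul_one_div K, abs_mul]
      exact mul_le_mul (bw1 t ht) (frac t) (abs_nonneg _) hK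
    · rw [div_eq_mul_one_div (K * (K * L)), mul_assoc K, abs_mul, abs_mul]
      exact mul_le_mul (bw t ht) (mul_le_mul (bF1 t ht) (frac2 t) (abs_nonneg _) hKL)
        (by positivity) hK
  have dE : ∀ t, HasDerivAt (fun t => -Complex.I * Complex.exp (φ t * Complex.I))
      (F t * Complex.exp (φ t * Complex.I)) t := by
    intro t
    have h := (((hφ t).ofReal_comp.mul_const Complex.I).cexp).const_mul (-Complex.I)
    refine h.congr_deriv ?_
    have : Complex.I * Complex.I = -1 := Complex.I_mul_I
    linear_combination ((F t : ℂ) * Complex.exp (φ t * Complex.I)) * -this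
  have nE : ∀ t, ‖Complex.exp (φ t * Complex.I)‖ = 1 := fun t => Complex.norm_exp_ofReal_mul_I _
  have ibp := intervalIntegral.integral_mul_deriv_eq_deriv_mul (a := 0) (b := T)
    (u := fun t => (G t : ℂ)) (u' := fun t => (G1 t : ℂ))
    (v := fun t => -Complex.I * Complex.exp (φ t * Complex.I))
    (v' := fun t => F t * Complex.exp (φ t * Complex.I))
    (fun t _ => (dG t).ofReal_comp) (fun t _ => dE t)
    ((Complex.continuous_ofReal.comp cG1).intervalIntegrable _ _)
    ((by fun_prop : Continuous fun t => (F t : ℂ) * Complex.exp (φ t * Complex.I)).intervalIntegrable _ _)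
  have e : ∀ t, ((w t * (F t ^ 2 / (F t ^ 2 + D ^ 2)) : ℝ) : ℂ) * Complex.exp (φ t * Complex.I)
      = (G t : ℂ) * (F t * Complex.exp (φ t * Complex.I)) := by
    intro t
    rw [← mul_assoc, ← Complex.ofReal_mul]
    congr 2
    simp only [hG]
    ring
  simp_rw [e]
  rw [ibp]
  have hb : ∀ t ∈ Set.Icc 0 T, ‖(G t : ℂ) * (-Complex.I * Complex.exp (φ t * Complex.I))‖ ≤ K / D := by
    intro t ht
    simp only [norm_mul, nE, norm_neg, Complex.norm_I, mul_one, Complex.norm_real]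
    exact bG t ht
  have eI : ‖∫ t in (0 : ℝ)..T, (G1 t : ℂ) * (-Complex.I * Complex.exp (φ t * Complex.I))‖ ≤
      (K / D + K * (K * L) / D ^ 2) * T := by
    have := intervalIntegral.norm_integral_le_of_norm_le_const (a := 0) (b := T)
      (C := K / D + K * (K * L) / D ^ 2)
      (f := fun t => (G1 t : ℂ) * (-Complex.I * Complex.exp (φ t * Complex.I))) (fun t ht => by
        rw [Set.uIoc_of_le hT] at ht
        simp only [norm_mul, nE, norm_neg, Complex.norm_I, mul_one, Complex.norm_real]
        exact bG1 t ⟨ht.1.le, ht.2⟩)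
    simpa [abs_of_nonneg hT] using this
  calc _ ≤ K / D + K / D + (K / D + K * (K * L) / D ^ 2) * T :=
        (norm_sub_le _ _).trans (add_le_add ((norm_sub_le _ _).trans
          (add_le_add (hb T ⟨hT, le_rfl⟩) (hb 0 ⟨le_rfl, hT⟩))) eI)
    _ = _ := by ring

/-- Decay of an oscillatory integral whose phase has no degenerate critical point. -/
theorem norm_oscillatory_integral_le {T K c μ : ℝ} {φ F F1 F2 w w1 : ℝ → ℝ} (hT : 0 ≤ T)
    (hc : 0 < c) (hμ : 1 ≤ μ)
    (hφ : ∀ t, HasDerivAt φ (F t) t)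
    (hF : ∀ t, HasDerivAt F (F1 t) t) (hF1 : ∀ t, HasDerivAt F1 (F2 t) t) (hF2 : Continuous F2)
    (hw : ∀ t, HasDerivAt w (w1 t) t) (hw1 : Continuous w1)
    (bF1 : ∀ t ∈ Set.Icc 0 T, |F1 t| ≤ K * μ ^ 3) (bF2 : ∀ t ∈ Set.Icc 0 T, |F2 t| ≤ K * μ ^ 3)
    (bw : ∀ t ∈ Set.Icc 0 T, |w t| ≤ K) (bw1 : ∀ t ∈ Set.Icc 0 T, |w1 t| ≤ K)
    (low : ∀ t ∈ Set.Icc 0 T, (c * μ ^ 3) ^ 2 ≤ F t ^ 2 + F1 t ^ 2) :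
    ‖∫ t in (0 : ℝ)..T, (w t : ℂ) * Complex.exp (φ t * Complex.I)‖ ≤
      (2 * K + (K + K ^ 2) * T + K * (T + K * (4 + 2 * T)) / c ^ 2) / μ := by
  have hμ0 : 0 < μ := by linarith
  have cF : Continuous F := continuous_iff_continuousAt.2 fun t => (hF t).continuousAt
  have cF1 : Continuous F1 := continuous_iff_continuousAt.2 fun t => (hF1 t).continuousAt
  have cw : Continuous w := continuous_iff_continuousAt.2 fun t => (hw t).continuousAt
  have cφ : Continuous φ := continuous_iff_continuousAt.2 fun t => (hφ t).continuousAt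
  have hK : 0 ≤ K := (abs_nonneg _).trans (bw 0 ⟨le_rfl, hT⟩)
  -- With `L = μ³`, the two parts have leading sizes `D / L` and `L / D²`. The choice `D = μ²`
  -- balances them at `1 / μ`; this is why frequencies are measured as a cube.
  have h1 := integral_cutoff_le (D := μ ^ 2) hT (by positivity) hF hF1
    hF2 bF1 bF2 low
  have h2 := norm_integral_nonstationary_le (D := μ ^ 2) hT (by positivity) hφ hF cF1 hw hw1 bF1 bw bw1
  have hpos : ∀ t, 0 < F t ^ 2 + (μ ^ 2) ^ 2 := fun t => by positivity
  have hne : ∀ t, F t ^ 2 + (μ ^ 2) ^ 2 ≠ 0 := fun t => (hpos t).ne'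
  have nE : ∀ t, ‖Complex.exp (φ t * Complex.I)‖ = 1 := fun t => Complex.norm_exp_ofReal_mul_I _
  set J := ∫ t in (0 : ℝ)..T, (μ ^ 2) ^ 2 / (F t ^ 2 + (μ ^ 2) ^ 2) with hJ
  have c3 : Continuous fun t => w t * (F t ^ 2 / (F t ^ 2 + (μ ^ 2) ^ 2)) := by
    fun_prop (disch := exact hne _)
  have c4 : Continuous fun t => w t * ((μ ^ 2) ^ 2 / (F t ^ 2 + (μ ^ 2) ^ 2)) := by
    fun_prop (disch := exact hne _)
  have c5 : Continuous fun t => (μ ^ 2) ^ 2 / (F t ^ 2 + (μ ^ 2) ^ 2) := by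
    fun_prop (disch := exact hne _)
  have c6 : Continuous fun t => Complex.exp (φ t * Complex.I) := by fun_prop
  have hsplit : ∫ t in (0 : ℝ)..T, (w t : ℂ) * Complex.exp (φ t * Complex.I) =
      (∫ t in (0 : ℝ)..T, (w t * (F t ^ 2 / (F t ^ 2 + (μ ^ 2) ^ 2)) : ℝ) * Complex.exp (φ t * Complex.I))
      + ∫ t in (0 : ℝ)..T, (w t * ((μ ^ 2) ^ 2 / (F t ^ 2 + (μ ^ 2) ^ 2)) : ℝ) *
        Complex.exp (φ t * Complex.I) := by
    have i3 : IntervalIntegrable (fun t => ((w t * (F t ^ 2 / (F t ^ 2 + (μ ^ 2) ^ 2)) : ℝ) : ℂ) *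
        Complex.exp (φ t * Complex.I)) volume 0 T :=
      ((Complex.continuous_ofReal.comp c3).mul c6).intervalIntegrable _ _
    have i4 : IntervalIntegrable (fun t => ((w t * ((μ ^ 2) ^ 2 / (F t ^ 2 + (μ ^ 2) ^ 2)) : ℝ) : ℂ) *
        Complex.exp (φ t * Complex.I)) volume 0 T :=
      ((Complex.continuous_ofReal.comp c4).mul c6).intervalIntegrable _ _
    rw [← intervalIntegral.integral_add i3 i4]
    congr 1
    ext t
    rw [← add_mul, ← Complex.ofReal_add, ← mul_add, ← add_div, div_self (hne t), mul_one]
  have h3 : ‖∫ t in (0 : ℝ)..T, (w t * ((μ ^ 2) ^ 2 / (F t ^ 2 + (μ ^ 2) ^ 2)) : ℝ) *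
        Complex.exp (φ t * Complex.I)‖ ≤ K * J := by
    rw [hJ, ← intervalIntegral.integral_const_mul]
    apply intervalIntegral.norm_integral_le_of_norm_le hT _
      ((continuous_const.mul c5).intervalIntegrable _ _)
    refine Filter.Eventually.of_forall fun t ht => ?_
    rw [norm_mul, nE, mul_one, Complex.norm_real, Real.norm_eq_abs, abs_mul,
      abs_of_nonneg (by positivity : 0 ≤ (μ ^ 2) ^ 2 / (F t ^ 2 + (μ ^ 2) ^ 2))]
    exact mul_le_mul_of_nonneg_right (bw t ⟨ht.1.le, ht.2⟩) (by positivity)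
  have h4 : J ≤ (T + K * (4 + 2 * T)) / c ^ 2 / μ := by
    rw [div_div, le_div_iff₀ (by positivity)]
    have h5 : (μ ^ 5) * (J * (c ^ 2 * μ)) ≤ μ ^ 5 * (T + K * (4 + 2 * T)) := by
      have : μ ^ 4 * T ≤ μ ^ 5 * T :=
        mul_le_mul_of_nonneg_right (pow_le_pow_right₀ hμ (by norm_num)) hT
      linarith
    exact le_of_mul_le_mul_left h5 (by positivity)
  have h6 : 2 * (K / μ ^ 2) + (K / μ ^ 2 + K * (K * μ ^ 3) / (μ ^ 2) ^ 2) * T ≤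
      (2 * K + (K + K ^ 2) * T) / μ := by
    have e1 : K / μ ^ 2 ≤ K / μ :=
      div_le_div_of_nonneg_left hK hμ0 (by nlinarith)
    have e2 : K * (K * μ ^ 3) / (μ ^ 2) ^ 2 = K ^ 2 / μ := by field_simp
    rw [e2]
    calc _ ≤ 2 * (K / μ) + (K / μ + K ^ 2 / μ) * T := by gcongr
      _ = _ := by ring
  rw [hsplit]
  calc _ ≤ (2 * K + (K + K ^ 2) * T) / μ + K * ((T + K * (4 + 2 * T)) / c ^ 2 / μ) :=
        (norm_add_le _ _).trans (add_le_add (h2.trans h6)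
          (h3.trans (mul_le_mul_of_nonneg_left h4 hK)))
    _ = _ := by ring

/-- A linear functional is not small on both vectors of a basis of the plane. -/
theorem lower_bound_of_det {p q s m K a0 a1 b0 b1 : ℝ} (hK : 0 < K)
    (hpq : p ^ 2 + q ^ 2 = s ^ 2) (k0 : a0 ^ 2 ≤ K ^ 2) (k1 : a1 ^ 2 ≤ K ^ 2)
    (k2 : b0 ^ 2 ≤ K ^ 2) (k3 : b1 ^ 2 ≤ K ^ 2) (hm : m ^ 2 ≤ (a0 * b1 - a1 * b0) ^ 2) :
    (m / (2 * K) * s) ^ 2 ≤ (p * a0 + q * a1) ^ 2 + (p * b0 + q * b1) ^ 2 := by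
  obtain ⟨u, hu⟩ : ∃ u, u = p * a0 + q * a1 := ⟨_, rfl⟩
  obtain ⟨v, hv⟩ : ∃ v, v = p * b0 + q * b1 := ⟨_, rfl⟩
  rw [← hu, ← hv]
  -- Cramer's rule: `p` and `q` are recovered from the two values `u`, `v` of the functional, up to
  -- the determinant.
  have e1 : p * (a0 * b1 - a1 * b0) = u * b1 - v * a1 := by rw [hu, hv]; ring
  have e2 : q * (a0 * b1 - a1 * b0) = v * a0 - u * b0 := by rw [hu, hv]; ring
  have i1 : (u * b1 - v * a1) ^ 2 ≤ (u ^ 2 + v ^ 2) * (b1 ^ 2 + a1 ^ 2) := by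
    linarith [sq_nonneg (u * a1 + v * b1)]
  have i2 : (v * a0 - u * b0) ^ 2 ≤ (u ^ 2 + v ^ 2) * (b0 ^ 2 + a0 ^ 2) := by
    linarith [sq_nonneg (u * a0 + v * b0)]
  have i3 : (p ^ 2 + q ^ 2) * (a0 * b1 - a1 * b0) ^ 2 ≤ (u ^ 2 + v ^ 2) * (4 * K ^ 2) := by
    calc _ = (u * b1 - v * a1) ^ 2 + (v * a0 - u * b0) ^ 2 := by rw [← e1, ← e2]; ring
      _ ≤ (u ^ 2 + v ^ 2) * (b1 ^ 2 + a1 ^ 2) + (u ^ 2 + v ^ 2) * (b0 ^ 2 + a0 ^ 2) := add_le_add i1 i2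
      _ = (u ^ 2 + v ^ 2) * (b1 ^ 2 + a1 ^ 2 + (b0 ^ 2 + a0 ^ 2)) := by ring
      _ ≤ _ := mul_le_mul_of_nonneg_left (by linarith) (by positivity)
  have i4 : s ^ 2 * m ^ 2 ≤ (u ^ 2 + v ^ 2) * (4 * K ^ 2) := by
    rw [← hpq]
    exact (mul_le_mul_of_nonneg_left hm (by positivity)).trans i3
  have : (m / (2 * K) * s) ^ 2 = s ^ 2 * m ^ 2 / (4 * K ^ 2) := by
    field_simp; ring
  rw [this, div_le_iff₀ (by positivity)]
  exact i4

/-- The Fourier coefficient of the arc length element of a nondegenerate plane arc decays. -/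
theorem exists_arc_decay {γ : ℝ → Plane} {T : ℝ} (hT : 0 ≤ T) (smooth : ContDiff ℝ ∞ γ)
    (regular : ∀ t, deriv γ t ≠ 0)
    (curved : ∀ t, deriv γ t 0 * deriv (deriv γ) t 1 - deriv γ t 1 * deriv (deriv γ) t 0 ≠ 0) :
    ∃ B : ℝ, 0 ≤ B ∧ ∀ p q μ : ℝ, 1 ≤ μ → p ^ 2 + q ^ 2 = (μ ^ 3) ^ 2 →
      ‖∫ t in (0 : ℝ)..T, (‖deriv γ t‖ : ℂ) *
        Complex.exp ((p * γ t 0 + q * γ t 1 : ℝ) * Complex.I)‖ ≤ B / μ := by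
  have s1 : ContDiff ℝ ∞ (deriv γ) := (contDiff_infty_iff_deriv.1 smooth).2
  have s2 : ContDiff ℝ ∞ (deriv (deriv γ)) := (contDiff_infty_iff_deriv.1 s1).2
  have s3 : ContDiff ℝ ∞ (deriv (deriv (deriv γ))) := (contDiff_infty_iff_deriv.1 s2).2
  have coord : ∀ {f : ℝ → Plane}, ContDiff ℝ ∞ f → ∀ (j : Fin 2) (t : ℝ),
      HasDerivAt (fun t => f t j) (deriv f t j) t := by
    intro f hf j t
    have h := (hf.differentiable (by simp) t).hasDerivAt
    exact (EuclideanSpace.proj (𝕜 := ℝ) j).hasFDerivAt.comp_hasDerivAt t h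
  have ccoord : ∀ {f : ℝ → Plane}, ContDiff ℝ ∞ f → ∀ j : Fin 2, Continuous fun t => f t j :=
    fun hf j => (EuclideanSpace.proj (𝕜 := ℝ) j).continuous.comp hf.continuous
  have sw : ContDiff ℝ ∞ fun t => ‖deriv γ t‖ := s1.norm ℝ regular
  have sw1 : ContDiff ℝ ∞ (deriv fun t => ‖deriv γ t‖) := (contDiff_infty_iff_deriv.1 sw).2
  have bdd : ∀ {f : ℝ → ℝ}, Continuous f → ∃ M : ℝ, ∀ t ∈ Set.Icc 0 T, |f t| ≤ M := by
    intro f hf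
    obtain ⟨M, hM⟩ := (isCompact_Icc (a := (0 : ℝ)) (b := T)).exists_bound_of_continuousOn hf.continuousOn
    exact ⟨M, fun t ht => by simpa using hM t ht⟩
  obtain ⟨M0, h0⟩ := bdd sw.continuous
  obtain ⟨M1, h1⟩ := bdd sw1.continuous
  obtain ⟨A0, ha0⟩ := bdd (ccoord s1 0)
  obtain ⟨A1, ha1⟩ := bdd (ccoord s1 1)
  obtain ⟨B0, hb0⟩ := bdd (ccoord s2 0)
  obtain ⟨B1, hb1⟩ := bdd (ccoord s2 1)
  obtain ⟨C0, hc0⟩ := bdd (ccoord s3 0)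
  obtain ⟨C1, hc1⟩ := bdd (ccoord s3 1)
  set det : ℝ → ℝ := fun t =>
    deriv γ t 0 * deriv (deriv γ) t 1 - deriv γ t 1 * deriv (deriv γ) t 0 with hdet
  have cdet : Continuous det :=
    ((ccoord s1 0).mul (ccoord s2 1)).sub ((ccoord s1 1).mul (ccoord s2 0))
  obtain ⟨t0, -, ht0⟩ := (isCompact_Icc (a := (0 : ℝ)) (b := T)).exists_isMinOn
    (Set.nonempty_Icc.2 hT) (f := fun t => |det t|) cdet.abs.continuousOn
  set m := |det t0| with hm
  have mpos : 0 < m := abs_pos.2 (curved t0)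
  set K := |M0| + |M1| + |A0| + |A1| + |B0| + |B1| + |C0| + |C1| + 1 with hK
  have n0 := abs_nonneg M0
  have n1 := abs_nonneg M1
  have n2 := abs_nonneg A0
  have n3 := abs_nonneg A1
  have n4 := abs_nonneg B0
  have n5 := abs_nonneg B1
  have n6 := abs_nonneg C0
  have n7 := abs_nonneg C1
  have Kpos : 0 < K := by positivity
  have sq_le : ∀ {x : ℝ}, |x| ≤ K → x ^ 2 ≤ K ^ 2 := fun hx => sq_le_sq' (by linarith [abs_le.1 hx]) (abs_le.1 hx).2
  -- The constant of `norm_oscillatory_integral_le` at `2 * K` and `c = m / (2 * K)`. The doubling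
  -- absorbs the two terms of `p * x + q * y`, each at most `K * μ ^ 3`; the value of `c` is the one
  -- from `lower_bound_of_det`.
  refine ⟨2 * (2 * K) + (2 * K + (2 * K) ^ 2) * T + (2 * K) * (T + (2 * K) * (4 + 2 * T)) / (m / (2 * K)) ^ 2,
    by positivity, ?_⟩
  intro p q μ hμ hpq
  have hμ3 : 0 ≤ μ ^ 3 := by positivity
  have hp : |p| ≤ μ ^ 3 := abs_le_of_sq_le_sq (by nlinarith [sq_nonneg q]) hμ3
  have hq : |q| ≤ μ ^ 3 := abs_le_of_sq_le_sq (by nlinarith [sq_nonneg p]) hμ3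
  have comb : ∀ {f : ℝ → Plane}, ContDiff ℝ ∞ f → ∀ t,
      HasDerivAt (fun t => p * f t 0 + q * f t 1) (p * deriv f t 0 + q * deriv f t 1) t :=
    fun hf t => ((coord hf 0 t).const_mul p).add ((coord hf 1 t).const_mul q)
  have bound : ∀ {x y : ℝ}, |x| ≤ K → |y| ≤ K → |p * x + q * y| ≤ (2 * K) * μ ^ 3 := by
    intro x y hx hy
    calc |p * x + q * y| ≤ |p| * |x| + |q| * |y| := by
          rw [← abs_mul, ← abs_mul]; exact abs_add_le _ _
      _ ≤ μ ^ 3 * K + μ ^ 3 * K := by gcongr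
      _ = _ := by ring
  apply norm_oscillatory_integral_le (φ := fun t => p * γ t 0 + q * γ t 1) hT
    (by positivity) hμ (comb smooth) (comb s1) (comb s2)
    ((continuous_const.mul (ccoord s3 0)).add (continuous_const.mul (ccoord s3 1)))
    (fun t => (sw.differentiable (by simp) t).hasDerivAt) sw1.continuous
  · intro t ht
    exact bound ((hb0 t ht).trans (by linarith [le_abs_self B0]))
      ((hb1 t ht).trans (by linarith [le_abs_self B1]))
  · intro t ht
    exact bound ((hc0 t ht).trans (by linarith [le_abs_self C0]))
      ((hc1 t ht).trans (by linarith [le_abs_self C1]))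
  · intro t ht
    exact (h0 t ht).trans (by linarith [le_abs_self M0])
  · intro t ht
    exact (h1 t ht).trans (by linarith [le_abs_self M1])
  · intro t ht
    have k0 := sq_le ((ha0 t ht).trans (by linarith [le_abs_self A0] : A0 ≤ K))
    have k1 := sq_le ((ha1 t ht).trans (by linarith [le_abs_self A1] : A1 ≤ K))
    have k2 := sq_le ((hb0 t ht).trans (by linarith [le_abs_self B0] : B0 ≤ K))
    have k3 := sq_le ((hb1 t ht).trans (by linarith [le_abs_self B1] : B1 ≤ K))
    have hmd : m ^ 2 ≤ det t ^ 2 := by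
      have := ht0 ht
      rw [← sq_abs (det t)]
      exact pow_le_pow_left₀ mpos.le this 2
    simp only [hdet] at hmd
    exact lower_bound_of_det Kpos hpq k0 k1 k2 k3 hmd

/-! ### Characters and Fourier coefficients of the arc length measure -/

theorem continuous_proj : Continuous proj :=
  continuous_pi fun i => (AddCircle.continuous_mk' _).comp (EuclideanSpace.proj (𝕜 := ℝ) i).continuous

/-- The character `x ↦ exp (i k·x)` of the torus. -/
def character (k : ℤ × ℤ) : C(Torus, ℂ) where
  toFun x := fourier k.1 (x 0) * fourier k.2 (x 1)
  continuous_toFun := by fun_prop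

theorem character_apply (k : ℤ × ℤ) (x : Torus) :
    character k x = fourier k.1 (x 0) * fourier k.2 (x 1) := rfl

theorem character_proj (k : ℤ × ℤ) (x : Plane) :
    character k (proj x) = Complex.exp (((k.1 : ℝ) * x 0 + (k.2 : ℝ) * x 1 : ℝ) * Complex.I) := by
  have h : ((2 * Real.pi : ℝ) : ℂ) ≠ 0 := by exact_mod_cast Real.two_pi_pos.ne'
  have h2 : (Real.pi : ℂ) ≠ 0 := by exact_mod_cast Real.pi_ne_zero
  rw [character_apply, proj, proj, fourier_coe_apply, fourier_coe_apply, ← Complex.exp_add]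
  congr 1
  push_cast
  field_simp

theorem norm_character (k : ℤ × ℤ) (x : Torus) : ‖character k x‖ = 1 := by
  simp only [character_apply, fourier_apply, norm_mul, Circle.norm_coe, mul_one]

theorem character_add (k l : ℤ × ℤ) (x : Torus) :
    character (k + l) x = character k x * character l x := by
  simp only [character_apply, Prod.fst_add, Prod.snd_add, fourier_add]; ring

theorem character_neg (k : ℤ × ℤ) (x : Torus) :
    character (-k) x = (starRingEnd ℂ) (character k x) := by
  simp only [character_apply, Prod.fst_neg, Prod.snd_neg, fourier_neg, map_mul]

theorem character_zero (x : Torus) : character 0 x = 1 := by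
  simp [character_apply]

theorem character_map_add (k : ℤ × ℤ) (x y : Torus) :
    character k (x + y) = character k x * character k y := by
  simp only [character_apply, Pi.add_apply, fourier_apply, smul_add, AddCircle.toCircle_add,
    Circle.coe_mul]
  ring

namespace ClosedCurve

variable (C : ClosedCurve)

theorem continuous_deriv_param (i : Fin C.numComponents) : Continuous (deriv (C.param i)) :=
  (C.smooth i).continuous_deriv (by simp)

instance isFiniteMeasure_component (i : Fin C.numComponents) :
    IsFiniteMeasure ((volume.restrict (Set.Ioc 0 (C.period i))).withDensity
      fun t => ENNReal.ofReal ‖deriv (C.param i) t‖) := by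
  apply isFiniteMeasure_withDensity_ofReal
  exact ((C.continuous_deriv_param i).norm.integrableOn_Ioc).2

instance : IsFiniteMeasure C.arcLength := by
  unfold arcLength
  infer_instance

theorem integral_arcLength (f : C(Torus, ℂ)) :
    ∫ x, f x ∂C.arcLength = ∑ i, ∫ t in (0 : ℝ)..C.period i,
      (‖deriv (C.param i) t‖ : ℂ) * f (proj (C.param i t)) := by
  have hm : ∀ i, Measurable fun t => proj (C.param i t) := fun i =>
    (continuous_proj.comp (C.smooth i).continuous).measurable
  unfold arcLength
  rw [integral_finsetSum_measure]
  · refine Finset.sum_congr rfl fun i _ => ?_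
    rw [integral_map (hm i).aemeasurable f.continuous.aestronglyMeasurable,
      integral_withDensity_eq_integral_toReal_smul
        (C.continuous_deriv_param i).norm.measurable.ennreal_ofReal (by simp),
      intervalIntegral.integral_of_le (C.period_pos i).le]
    simp
  · intro i _
    obtain ⟨M, hM⟩ := isCompact_univ.exists_bound_of_continuousOn f.continuous.continuousOn
    exact Integrable.of_bound f.continuous.aestronglyMeasurable M
      (Eventually.of_forall fun x => hM x trivial)

/-- The Fourier coefficients of the arc length measure of a curve with nonvanishing curvature decay. -/
theorem exists_fourier_decay (hC : ∀ i t, C.curvature i t ≠ 0) :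
    ∃ B : ℝ, 0 ≤ B ∧ ∀ (k : ℤ × ℤ) (μ : ℝ), 1 ≤ μ → (k.1 : ℝ) ^ 2 + (k.2 : ℝ) ^ 2 = (μ ^ 3) ^ 2 →
      ‖∫ x, character k x ∂C.arcLength‖ ≤ B / μ := by
  have h := fun i => exists_arc_decay (C.period_pos i).le (C.smooth i) (C.regular i)
    (fun t h0 => hC i t (by rw [curvature, h0, zero_div]))
  choose B hB0 hB using h
  refine ⟨∑ i, B i, Finset.sum_nonneg fun i _ => hB0 i, fun k μ hμ hk => ?_⟩
  rw [integral_arcLength, Finset.sum_div]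
  refine norm_sum_le_of_le _ fun i _ => ?_
  simp_rw [character_proj]
  exact hB i k.1 k.2 μ hμ hk

end ClosedCurve

/-! ### Fourier analysis on the torus -/

instance : IsProbabilityMeasure normalizedVolume := by
  unfold normalizedVolume; infer_instance

instance : normalizedVolume.IsAddHaarMeasure := by
  unfold normalizedVolume; infer_instance

theorem isOpenQuotientMap_proj : IsOpenQuotientMap proj := by
  have h1 : IsOpenQuotientMap (Pi.map fun (_ : Fin 2) (s : ℝ) => (s : AddCircle (2 * Real.pi))) :=
    IsOpenQuotientMap.piMap fun _ => QuotientAddGroup.isOpenQuotientMap_mk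
  exact h1.comp (EuclideanSpace.equiv (Fin 2) ℝ).toHomeomorph.isOpenQuotientMap

theorem proj_add (x y : Plane) : proj (x + y) = proj x + proj y := by
  ext i; simp [proj]

theorem proj_single (j : Fin 2) (s : ℝ) :
    proj (EuclideanSpace.single j s) = Pi.single j (s : AddCircle (2 * Real.pi)) := by
  ext i
  by_cases h : i = j
  · subst h; simp [proj]
  · simp [proj, h]

/-- A periodic continuous function on the plane descends to the torus. -/
theorem exists_descent {g : Plane → ℂ} (hg : Continuous g)
    (h : ∀ x v, proj v = 0 → g (x + v) = g x) : ∃ G : C(Torus, ℂ), ∀ x, G (proj x) = g x := by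
  have hfac : Function.FactorsThrough (⟨g, hg⟩ : C(Plane, ℂ)) (⟨proj, continuous_proj⟩ : C(Plane, Torus)) := by
    intro x y hxy
    have hxy' : proj x = proj y := hxy
    have e := proj_add x (y - x)
    rw [add_sub_cancel, ← hxy'] at e
    have := h x (y - x) (by simpa using e)
    rw [add_sub_cancel] at this
    exact this.symm
  have hq : IsQuotientMap (⟨proj, continuous_proj⟩ : C(Plane, Torus)) := isOpenQuotientMap_proj.isQuotientMap
  refine ⟨hq.lift ⟨g, hg⟩ hfac, fun x => ?_⟩
  exact congrArg (fun f : C(Plane, ℂ) => f x) (hq.lift_comp ⟨g, hg⟩ hfac)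

/-- The linear span of the characters is dense in the continuous functions. -/
theorem span_character_closure_eq_top :
    (Submodule.span ℂ (Set.range character)).topologicalClosure = ⊤ := by
  let A : StarSubalgebra ℂ C(Torus, ℂ) :=
    { toSubalgebra := Algebra.adjoin ℂ (Set.range character)
      star_mem' := by
        change Algebra.adjoin ℂ (Set.range character) ≤ star (Algebra.adjoin ℂ (Set.range character))
        refine Algebra.adjoin_le ?_
        rintro _ ⟨k, rfl⟩
        refine Algebra.subset_adjoin ⟨-k, ?_⟩
        ext1 x
        simp only [character_neg, starRingEnd_apply, ContinuousMap.star_apply] }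
  have hA : A.toSubalgebra.toSubmodule = Submodule.span ℂ (Set.range character) := by
    apply Algebra.adjoin_eq_span_of_subset
    refine .trans (fun x => Submonoid.closure_induction (fun _ => id) ⟨0, ?_⟩ ?_) Submodule.subset_span
    · ext x
      simp [character_zero]
    · rintro _ _ _ _ ⟨k, rfl⟩ ⟨l, rfl⟩
      refine ⟨k + l, ?_⟩
      ext x
      simp [character_add]
  have hsep : A.SeparatesPoints := by
    intro x y hxy
    rw [Ne, funext_iff, not_forall] at hxy
    obtain ⟨i, hi⟩ := hxy
    have hinj : Function.Injective fun z : AddCircle (2 * Real.pi) => (fourier 1 z : ℂ) := by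
      intro a b hab
      simp only [fourier_one, Circle.coe_inj] at hab
      exact AddCircle.injective_toCircle Real.two_pi_pos.ne' hab
    fin_cases i
    · refine ⟨_, ⟨character (1, 0), Algebra.subset_adjoin ⟨_, rfl⟩, rfl⟩, ?_⟩
      simp only [character_apply, fourier_zero, mul_one]; exact fun h => hi (hinj h)
    · refine ⟨_, ⟨character (0, 1), Algebra.subset_adjoin ⟨_, rfl⟩, rfl⟩, ?_⟩
      simp only [character_apply, fourier_zero, one_mul]; exact fun h => hi (hinj h)
  rw [← hA]
  exact congr_arg (Subalgebra.toSubmodule <| StarSubalgebra.toSubalgebra ·)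
    (ContinuousMap.starSubalgebra_topologicalClosure_eq_top_of_separatesPoints _ hsep)

/-- Trigonometric polynomials approximate continuous functions uniformly. -/
theorem exists_span_near (a : C(Torus, ℂ)) {ε : ℝ} (hε : 0 < ε) :
    ∃ b ∈ Submodule.span ℂ (Set.range character), ‖a - b‖ < ε := by
  have h : a ∈ closure (Submodule.span ℂ (Set.range character) : Set C(Torus, ℂ)) := by
    rw [← Submodule.topologicalClosure_coe, span_character_closure_eq_top]
    trivial
  obtain ⟨b, hb, hab⟩ := Metric.mem_closure_iff.1 h ε hε
  exact ⟨b, hb, by rwa [dist_eq_norm] at hab⟩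

theorem integrable_continuousMap {μ : Measure Torus} [IsFiniteMeasure μ] (f : C(Torus, ℂ)) :
    Integrable (fun x => f x) μ :=
  Integrable.of_bound f.continuous.aestronglyMeasurable ‖f‖
    (Eventually.of_forall fun x => f.norm_coe_le_norm x)

theorem integrable_mul {μ : Measure Torus} [IsFiniteMeasure μ] (f g : C(Torus, ℂ)) :
    Integrable (fun x => f x * g x) μ :=
  integrable_continuousMap (f * g)

/-- The Fourier coefficients of a continuous function. -/
def coeff (u : C(Torus, ℂ)) (k : ℤ × ℤ) : ℂ := ∫ x, u x * character (-k) x ∂normalizedVolume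

theorem coeff_add (u v : C(Torus, ℂ)) (k : ℤ × ℤ) : coeff (u + v) k = coeff u k + coeff v k := by
  simp only [coeff, ContinuousMap.add_apply, add_mul]
  exact integral_add (integrable_mul u (character (-k)))
    (integrable_mul v (character (-k)))

theorem coeff_smul (c : ℂ) (u : C(Torus, ℂ)) (k : ℤ × ℤ) : coeff (c • u) k = c * coeff u k := by
  simp only [coeff, ContinuousMap.smul_apply, smul_eq_mul, mul_assoc]
  exact integral_const_mul _ _

theorem coeff_sum {ι : Type*} (s : Finset ι) (u : ι → C(Torus, ℂ)) (k : ℤ × ℤ) :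
    coeff (∑ i ∈ s, u i) k = ∑ i ∈ s, coeff (u i) k := by
  classical
  induction s using Finset.induction_on with
  | empty => simp [coeff]
  | insert i s hi ih => rw [Finset.sum_insert hi, Finset.sum_insert hi, coeff_add, ih]

/-- Haar measure is translation invariant, while translation by half a period in a coordinate where
`k` is nonzero changes the sign of the character. -/
theorem integral_character {k : ℤ × ℤ} (hk : k ≠ 0) : ∫ x, character k x ∂normalizedVolume = 0 := by
  obtain ⟨v, hv⟩ : ∃ v : Torus, character k v = -1 := by
    by_cases h1 : k.1 = 0
    · have h2 : (k.2 : ℝ) ≠ 0 := by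
        intro h2
        exact hk (Prod.ext h1 (by exact_mod_cast h2))
      refine ⟨proj (EuclideanSpace.single 1 (Real.pi / k.2)), ?_⟩
      rw [character_proj]
      simp only [PiLp.single_apply]
      simp [h1, mul_div_cancel₀ _ h2]
    · have h2 : (k.1 : ℝ) ≠ 0 := by exact_mod_cast h1
      refine ⟨proj (EuclideanSpace.single 0 (Real.pi / k.1)), ?_⟩
      rw [character_proj]
      simp [mul_div_assoc', mul_div_cancel_left₀ (Real.pi : ℂ) (by exact_mod_cast h2 : (k.1 : ℂ) ≠ 0)]
  have h := integral_add_right_eq_self (μ := normalizedVolume) (fun x => character k x) v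
  simp_rw [character_map_add, hv, mul_neg_one] at h
  rw [integral_neg] at h
  exact self_eq_neg.1 h.symm

theorem coeff_character (k l : ℤ × ℤ) : coeff (character l) k = if k = l then 1 else 0 := by
  unfold coeff
  simp_rw [← character_add]
  split_ifs with h
  · subst h
    simp [character_zero]
  · exact integral_character fun h' => h (by rwa [← sub_eq_add_neg, sub_eq_zero, eq_comm] at h')

/-- A continuous function without Fourier coefficients vanishes. -/
theorem eq_zero_of_coeff_eq_zero {u : C(Torus, ℂ)} (h : ∀ k, coeff u k = 0) : u = 0 := by
  have hspan : ∀ b ∈ Submodule.span ℂ (Set.range character),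
      ∫ x, u x * b x ∂normalizedVolume = 0 := by
    intro b hb
    induction hb using Submodule.span_induction with
    | mem b hb =>
      obtain ⟨k, rfl⟩ := hb
      simpa [coeff] using h (-k)
    | zero => simp
    | add b c _ _ hb hc =>
      simp only [ContinuousMap.add_apply, mul_add]
      exact (integral_add (integrable_mul u b) (integrable_mul u c)).trans
        (by rw [hb, hc, add_zero])
    | smul c b _ hb =>
      simp only [ContinuousMap.smul_apply, smul_eq_mul, mul_left_comm _ c]
      rw [integral_const_mul, hb, mul_zero]
  have hsq : ∫ x, u x * (star u) x ∂normalizedVolume = 0 := by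
    -- The vanishing coefficients make `u` orthogonal to every trigonometric polynomial, and these
    -- approximate `star u` uniformly.
    have : ∀ ε : ℝ, 0 < ε → ‖∫ x, u x * (star u) x ∂normalizedVolume‖ ≤ ‖u‖ * ε := by
      intro ε hε
      obtain ⟨b, hb, hab⟩ := exists_span_near (star u) hε
      have e : ∫ x, u x * (star u) x ∂normalizedVolume
          = ∫ x, u x * (star u - b) x ∂normalizedVolume := by
        simp only [ContinuousMap.sub_apply, mul_sub]
        rw [integral_sub (integrable_mul u (star u)) (integrable_mul u b),
          hspan b hb, sub_zero]
      rw [e]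
      have := norm_integral_le_of_norm_le_const (μ := normalizedVolume) (C := ‖u‖ * ε)
        (f := fun x => u x * (star u - b) x) (Eventually.of_forall fun x => by
          rw [norm_mul]
          exact mul_le_mul (u.norm_coe_le_norm x)
            (((star u - b).norm_coe_le_norm x).trans hab.le) (norm_nonneg _) (norm_nonneg _))
      simpa using this
    rw [← norm_eq_zero]
    refine le_antisymm (le_of_forall_pos_le_add fun ε hε => ?_) (norm_nonneg _)
    have hn : 0 < ‖u‖ + 1 := by positivity
    refine (this (ε / (‖u‖ + 1)) (by positivity)).trans ?_
    rw [zero_add, mul_div_assoc', div_le_iff₀ hn]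
    nlinarith [norm_nonneg u]
  have hsq2 : ∫ x, ‖u x‖ ^ 2 ∂normalizedVolume = 0 := by
    have e : ∀ x, u x * (star u) x = ((‖u x‖ ^ 2 : ℝ) : ℂ) := by
      intro x
      rw [ContinuousMap.star_apply, Complex.star_def, Complex.mul_conj']
      push_cast; rfl
    simp_rw [e] at hsq
    rw [integral_complex_ofReal] at hsq
    exact_mod_cast hsq
  have hc : Continuous fun x => ‖u x‖ ^ 2 := by fun_prop
  have hi : Integrable (fun x => ‖u x‖ ^ 2) normalizedVolume :=
    Integrable.of_bound hc.aestronglyMeasurable (‖u‖ ^ 2) (Eventually.of_forall fun x => by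
      rw [Real.norm_eq_abs, abs_of_nonneg (by positivity)]
      exact pow_le_pow_left₀ (norm_nonneg _) (u.norm_coe_le_norm x) 2)
  have hae := (integral_eq_zero_iff_of_nonneg (fun x => by positivity) hi).1 hsq2
  have := (hc.ae_eq_iff_eq normalizedVolume continuous_zero).1 hae
  ext x
  have := congrFun this x
  simpa using this

/-- The `j`-th component of a frequency. -/
def freq (k : ℤ × ℤ) (j : Fin 2) : ℤ := ![k.1, k.2] j

theorem character_single (k : ℤ × ℤ) (j : Fin 2) (s : ℝ) :
    character k (Pi.single j (s : AddCircle (2 * Real.pi))) = Complex.exp (s * (Complex.I * freq k j)) := by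
  rw [← proj_single, character_proj]
  congr 1
  fin_cases j <;> simp [freq] <;> ring

/-- Translating `u` by `S s` multiplies its coefficient at `k` by `exp (s * w)`, by invariance of
the measure. Differentiating this identity at `s = 0` under the integral replaces integration by
parts on the torus. -/
theorem coeff_of_hasDerivAt_along {S : ℝ → Torus}
    (hS : ∀ s t, S (s + t) = S s + S t) {u u1 : C(Torus, ℂ)} {k : ℤ × ℤ} {w : ℂ}
    (hk : ∀ s : ℝ, character k (S s) = Complex.exp (s * w))
    (h : ∀ x, HasDerivAt (fun s : ℝ => u (x + S s)) (u1 x) 0) :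
    coeff u1 k = w * coeff u k := by
  -- Since `S` is additive, differentiability at `0` from every base point gives it at every time
  -- along each orbit.
  have hall : ∀ x (s0 : ℝ), HasDerivAt (fun s : ℝ => u (x + S s)) (u1 (x + S s0)) s0 := by
    intro x s0
    have h1 := h (x + S s0)
    rw [← sub_self s0] at h1
    refine (h1.comp_sub_const s0 s0).congr_of_eventuallyEq (Eventually.of_forall fun s => ?_)
    have e : S s = S s0 + S (s - s0) := by rw [← hS, add_sub_cancel]
    simp only [e, add_assoc]
  have hφ : ∀ s : ℝ, ∫ x, u (x + S s) * character (-k) x ∂normalizedVolume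
      = Complex.exp (s * w) * coeff u k := by
    intro s
    rw [← hk, coeff, ← integral_const_mul,
      ← integral_add_right_eq_self (fun x => character k (S s) * (u x * character (-k) x)) (S s)]
    congr 1
    ext x
    have e : character k (S s) * character (-k) (S s) = 1 := by
      rw [← character_add, add_neg_cancel, character_zero]
    rw [character_map_add]
    linear_combination (-(u (x + S s)) * character (-k) x) * e
  have i0 : Integrable (fun x => u (x + S 0) * character (-k) x) normalizedVolume :=
    integrable_mul (u.comp ⟨fun x => x + S 0, by fun_prop⟩) (character (-k))
  have m1 : AEStronglyMeasurable (fun x => u1 (x + S 0) * character (-k) x) normalizedVolume :=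
    Continuous.aestronglyMeasurable (by fun_prop)
  have m0 : ∀ᶠ s in 𝓝 (0 : ℝ),
      AEStronglyMeasurable (fun x => u (x + S s) * character (-k) x) normalizedVolume :=
    Eventually.of_forall fun s => Continuous.aestronglyMeasurable (by fun_prop)
  have hb : ∀ᵐ x ∂normalizedVolume, ∀ s ∈ (Set.univ : Set ℝ),
      ‖u1 (x + S s) * character (-k) x‖ ≤ ‖u1‖ :=
    Eventually.of_forall fun x s _ => by
      rw [norm_mul, norm_character, mul_one]; exact u1.norm_coe_le_norm _
  have hd : ∀ᵐ x ∂normalizedVolume, ∀ s ∈ (Set.univ : Set ℝ),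
      HasDerivAt (fun s => u (x + S s) * character (-k) x) (u1 (x + S s) * character (-k) x) s :=
    Eventually.of_forall fun x s _ => (hall x s).mul_const _
  have d1 := (hasDerivAt_integral_of_dominated_loc_of_deriv_le univ_mem m0 i0 m1 hb
    (integrable_const _) hd).2
  simp_rw [hφ] at d1
  have d2 : HasDerivAt (fun s : ℝ => Complex.exp (s * w) * coeff u k) (w * coeff u k) 0 := by
    simpa using ((Complex.ofRealCLM.hasDerivAt (x := (0 : ℝ))).mul_const w).cexp.mul_const (coeff u k)
  have hS0 : S 0 = 0 := by simpa using hS 0 0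
  have := d1.unique d2
  simpa only [coeff, hS0, add_zero] using this

theorem coeff_of_hasDerivAt {u u1 : C(Torus, ℂ)} {j : Fin 2}
    (h : ∀ x, HasDerivAt (fun s : ℝ => u (x + Pi.single j (s : AddCircle (2 * Real.pi)))) (u1 x) 0)
    (k : ℤ × ℤ) : coeff u1 k = Complex.I * freq k j * coeff u k :=
  coeff_of_hasDerivAt_along (S := fun s => Pi.single j (s : AddCircle (2 * Real.pi)))
    (fun s t => by rw [AddCircle.coe_add, Pi.single_add]) (character_single k j) h

theorem exists_partial_deriv (u : C(Torus, ℂ)) (hu : ContDiff ℝ 1 fun x => u (proj x)) (j : Fin 2) :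
    ∃ u1 : C(Torus, ℂ),
      (∀ x, u1 (proj x) = fderiv ℝ (fun x => u (proj x)) x (EuclideanSpace.single j 1)) ∧
      ∀ k, coeff u1 k = Complex.I * freq k j * coeff u k := by
  obtain ⟨u1, h1⟩ := exists_descent
    (g := fun x => fderiv ℝ (fun x => u (proj x)) x (EuclideanSpace.single j 1))
    ((hu.continuous_fderiv (by simp)).clm_apply continuous_const) (by
      intro x v hv
      have : (fun x => u (proj x)) = fun x => u (proj (x + v)) := by
        ext x; rw [proj_add, hv, add_zero]
      conv_rhs => rw [this]
      rw [fderiv_comp_add_right (f := fun x => u (proj x))])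
  refine ⟨u1, h1, fun k => coeff_of_hasDerivAt (fun y => ?_) k⟩
  obtain ⟨x, rfl⟩ := isOpenQuotientMap_proj.surjective y
  rw [h1]
  have hd : HasFDerivAt (fun x => u (proj x)) (fderiv ℝ (fun x => u (proj x)) x)
      (x + (0 : ℝ) • EuclideanSpace.single j (1 : ℝ)) := by
    rw [zero_smul, add_zero]
    exact (hu.differentiable (by simp) x).hasFDerivAt
  have hl : HasDerivAt (fun s : ℝ => x + s • EuclideanSpace.single j (1 : ℝ))
      (EuclideanSpace.single j (1 : ℝ)) 0 := by
    simpa using ((hasDerivAt_id (0 : ℝ)).smul_const (EuclideanSpace.single j (1 : ℝ))).const_add x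
  have := hd.comp_hasDerivAt 0 hl
  refine this.congr_of_eventuallyEq (Eventually.of_forall fun s => ?_)
  have : s • EuclideanSpace.single j (1 : ℝ) = EuclideanSpace.single j s := by
    ext i; by_cases hi : i = j <;> simp [hi]
  simp only [Function.comp_apply, proj_add, this, proj_single]

/-! ### Eigenfunctions as trigonometric polynomials -/

/-- The integer points on the circle of radius `√E`. -/
def circlePoints (E : ℕ) : Finset (ℤ × ℤ) :=
  (Finset.Icc (-(E : ℤ)) E ×ˢ Finset.Icc (-(E : ℤ)) E).filter fun k => k.1 ^ 2 + k.2 ^ 2 = E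

theorem mem_circlePoints {E : ℕ} {k : ℤ × ℤ} : k ∈ circlePoints E ↔ k.1 ^ 2 + k.2 ^ 2 = E := by
  simp only [circlePoints, Finset.mem_filter, Finset.mem_product, Finset.mem_Icc, and_iff_right_iff_imp]
  intro h
  have h1 : |k.1| ≤ E := by
    have := (Int.natCast_natAbs k.1) ▸ Int.natAbs_le_self_sq k.1
    nlinarith [sq_nonneg k.2]
  have h2 : |k.2| ≤ E := by
    have := (Int.natCast_natAbs k.2) ▸ Int.natAbs_le_self_sq k.2
    nlinarith [sq_nonneg k.1]
  exact ⟨abs_le.1 h1, abs_le.1 h2⟩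

theorem IsNormalizedEigenfunction.exists_continuousMap {ψ : Torus → ℂ} {lam : ℝ}
    (h : IsNormalizedEigenfunction ψ lam) : ∃ u : C(Torus, ℂ), ⇑u = ψ :=
  ⟨⟨ψ, isOpenQuotientMap_proj.isQuotientMap.continuous_iff.2 h.contDiff.continuous⟩, rfl⟩

/-- Each second partial derivative multiplies the coefficient by `(I * freq k j)²`, so the
eigenvalue equation becomes algebraic on the Fourier side. The two derivatives are taken one at a
time because `u` is only assumed `C²`. -/
theorem coeff_mul_eq {u : C(Torus, ℂ)} {lam : ℝ} (h : IsNormalizedEigenfunction u lam) (k : ℤ × ℤ) :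
    ((k.1 : ℂ) ^ 2 + (k.2 : ℂ) ^ 2) * coeff u k = (lam : ℂ) ^ 2 * coeff u k := by
  have hu : ContDiff ℝ 2 fun x => u (proj x) := h.contDiff
  have hfd : ContDiff ℝ 1 (fderiv ℝ fun x => u (proj x)) := hu.fderiv_right (by norm_num)
  choose u1 h1 hc1 using exists_partial_deriv u (hu.of_le (by norm_num))
  have hu1 : ∀ j, ContDiff ℝ 1 fun x => u1 j (proj x) := by
    intro j
    simp_rw [h1]
    exact hfd.clm_apply contDiff_const
  have h2 := fun j => exists_partial_deriv (u1 j) (hu1 j) j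
  choose u2 h2 hc2 using h2
  have hL : u2 0 + u2 1 = (-((lam : ℂ) ^ 2)) • u := by
    ext y
    obtain ⟨x, rfl⟩ := isOpenQuotientMap_proj.surjective y
    have he := h.eigen x
    rw [InnerProductSpace.laplacian_eq_iteratedFDeriv_orthonormalBasis _ (EuclideanSpace.basisFun (Fin 2) ℝ)] at he
    simp only [Fin.sum_univ_two, iteratedFDeriv_two_apply, EuclideanSpace.basisFun_apply, Matrix.cons_val_zero,
      Matrix.cons_val_one] at he
    have e : ∀ j, u2 j (proj x) = fderiv ℝ (fderiv ℝ fun y => u (proj y)) x (EuclideanSpace.single j 1)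
        (EuclideanSpace.single j 1) := by
      intro j
      rw [h2]
      simp_rw [h1]
      rw [fderiv_clm_apply (hfd.differentiable (by simp) x) (differentiableAt_const _)]
      simp
    simp only [ContinuousMap.add_apply, ContinuousMap.smul_apply, smul_eq_mul, e]
    exact he
  have := congrArg (fun v => coeff v k) hL
  simp only [coeff_add, coeff_smul, hc2, hc1] at this
  simp only [freq, Matrix.cons_val_zero, Matrix.cons_val_one] at this
  have hI : Complex.I * Complex.I = -1 := Complex.I_mul_I
  linear_combination -this + ((k.1 : ℂ) ^ 2 + (k.2 : ℂ) ^ 2) * coeff u k * hI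

/-- Toral eigenfunctions are trigonometric polynomials with frequencies on a circle. -/
theorem IsNormalizedEigenfunction.expansion {u : C(Torus, ℂ)} {lam : ℝ} {E : ℕ}
    (h : IsNormalizedEigenfunction u lam) (hE : lam ^ 2 = E) :
    u = ∑ k ∈ circlePoints E, coeff u k • character k := by
  have hsupp : ∀ k, k ∉ circlePoints E → coeff u k = 0 := by
    intro k hk
    by_contra hne
    have := mul_right_cancel₀ hne (coeff_mul_eq h k)
    rw [← Complex.ofReal_pow, hE] at this
    exact hk (mem_circlePoints.2 (by exact_mod_cast this))
  rw [← sub_eq_zero]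
  apply eq_zero_of_coeff_eq_zero
  intro k
  rw [sub_eq_add_neg, ← neg_one_smul ℂ, coeff_add, coeff_smul, coeff_sum]
  simp_rw [coeff_smul, coeff_character, mul_ite, mul_one, mul_zero]
  rw [Finset.sum_ite_eq]
  split_ifs with hk
  · ring
  · rw [hsupp k hk]; ring

theorem IsNormalizedEigenfunction.sum_sq_coeff {u : C(Torus, ℂ)} {lam : ℝ} {E : ℕ}
    (h : IsNormalizedEigenfunction u lam) (hE : lam ^ 2 = E) :
    ∑ k ∈ circlePoints E, ‖coeff u k‖ ^ 2 = 1 := by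
  have hx := h.expansion hE
  have e : ∀ x, ((‖u x‖ ^ 2 : ℝ) : ℂ) = ∑ k ∈ circlePoints E,
      (starRingEnd ℂ) (coeff u k) * (u x * character (-k) x) := by
    intro x
    have hx' : u x = ∑ k ∈ circlePoints E, coeff u k * character k x := by
      conv_lhs => rw [hx]
      simp [ContinuousMap.sum_apply]
    have e1 : ((‖u x‖ ^ 2 : ℝ) : ℂ) = u x * (starRingEnd ℂ) (u x) := by
      rw [Complex.mul_conj']; push_cast; rfl
    have e2 : (starRingEnd ℂ) (u x) =
        ∑ k ∈ circlePoints E, (starRingEnd ℂ) (coeff u k) * character (-k) x := by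
      rw [hx', map_sum]
      simp_rw [map_mul, character_neg]
    rw [e1, e2, Finset.mul_sum]
    exact Finset.sum_congr rfl fun k _ => by ring
  have hn : ((∫ x, ‖u x‖ ^ 2 ∂normalizedVolume : ℝ) : ℂ) = 1 := by rw [h.normalized]; simp
  rw [← integral_complex_ofReal] at hn
  simp_rw [e] at hn
  rw [integral_finsetSum _ fun k _ => (integrable_mul u (character (-k))).const_mul ((starRingEnd ℂ) (coeff u k))] at hn
  simp_rw [integral_const_mul] at hn
  have e3 : ∀ k, (starRingEnd ℂ) (coeff u k) * ∫ x, u x * character (-k) x ∂normalizedVolume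
      = ((‖coeff u k‖ ^ 2 : ℝ) : ℂ) := by
    intro k
    rw [← coeff, Complex.conj_mul']; push_cast; rfl
  simp_rw [e3] at hn
  exact_mod_cast hn

/-! ### Counting pairs of lattice points on a common circle -/

/-- The integer points of the square `[-Y, Y]²`. -/
def square (Y : ℕ) : Finset (ℤ × ℤ) := Finset.Icc (-(Y : ℤ)) Y ×ˢ Finset.Icc (-(Y : ℤ)) Y

theorem mem_square {Y : ℕ} {k : ℤ × ℤ} : k ∈ square Y ↔ |k.1| ≤ Y ∧ |k.2| ≤ Y := by
  simp [square, abs_le]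

theorem card_square (Y : ℕ) : (square Y).card = (2 * Y + 1) ^ 2 := by
  have : ((Y : ℤ) + 1 - -(Y : ℤ)).toNat = 2 * Y + 1 := by omega
  rw [square, Finset.card_product, Int.card_Icc, this]; ring

/-- Pairs of distinct points of the square on a common circle, at distance at most `M`. -/
def closePairs (Y M : ℕ) : Finset ((ℤ × ℤ) × ℤ × ℤ) :=
  (square Y ×ˢ square Y).filter fun x =>
    x.1 ≠ x.2 ∧ x.1.1 ^ 2 + x.1.2 ^ 2 = x.2.1 ^ 2 + x.2.2 ^ 2 ∧
      |x.1.1 - x.2.1| ≤ M ∧ |x.1.2 - x.2.2| ≤ M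

theorem mul_eq_mul_param {u v w z : ℤ} (h : u * v = w * z) (h0 : u ≠ 0 ∨ w ≠ 0) :
    ∃ d a b t : ℤ, 0 < d ∧ (a ≠ 0 ∨ b ≠ 0) ∧ u = d * a ∧ w = d * b ∧ v = b * t ∧ z = a * t := by
  have hg : 0 < Int.gcd u w := Int.gcd_pos_iff.2 h0
  obtain ⟨d, a, b, hd, hab, rfl, rfl⟩ : ∃ d a b : ℤ, 0 < d ∧ Int.gcd a b = 1 ∧ u = d * a ∧ w = d * b := by
    obtain ⟨a, b, hab, ha, hb⟩ := Int.exists_gcd_one hg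
    exact ⟨Int.gcd u w, a, b, by exact_mod_cast hg, hab, by rw [mul_comm]; exact ha,
      by rw [mul_comm]; exact hb⟩
  have h1 : a * v = b * z := mul_left_cancel₀ hd.ne' (by linarith)
  obtain ⟨x, y, hxy⟩ : ∃ x y : ℤ, a * x + b * y = 1 :=
    ⟨_, _, by rw [← Int.gcd_eq_gcd_ab, hab]; rfl⟩
  -- From `a v = b z` and the Bézout relation `a x + b y = 1`, the common cofactor is `t = x z + y
  -- v`.
  refine ⟨d, a, b, x * z + y * v, hd, ?_, rfl, rfl, ?_, ?_⟩
  · by_contra hcon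
    push Not at hcon
    simp [hcon.1, hcon.2] at hxy
  · linear_combination (-v) * hxy + x * h1
  · linear_combination (-z) * hxy - y * h1

/-- Equality of norms factors as `(k1 - l1)(k1 + l1) = (l2 - k2)(l2 + k2)`, so a pair is encoded by
`(a, b)`, `d`, `t`. With `m = max |a| |b|` there are `8 m` choices of `(a, b)`, at most `M / m` of
`d`, because `d * m ≤ M`, and `2 (2 Y / m) + 1` of `t`, because `|t| * m ≤ 2 Y`. -/
theorem card_closePairs_le_sum (Y M : ℕ) :
    (closePairs Y M).card ≤ ∑ m ∈ Finset.Icc 1 M, 8 * m * ((M / m) * (2 * (2 * Y / m) + 1)) := by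
  classical
  let T : ℕ → Finset ((ℤ × ℤ) × ℤ × ℤ) := fun m =>
    Finset.box m ×ˢ Finset.Icc (1 : ℤ) (M / m : ℕ) ×ˢ Finset.Icc (-((2 * Y / m : ℕ) : ℤ)) (2 * Y / m : ℕ)
  let F : (ℤ × ℤ) × ℤ × ℤ → ℤ × ℤ × ℤ × ℤ := fun x =>
    (x.2.1 * x.1.1, x.1.2 * x.2.2, x.2.1 * x.1.2, x.1.1 * x.2.2)
  have hT : ∀ m ∈ Finset.Icc 1 M, ((T m).image F).card ≤ 8 * m * ((M / m) * (2 * (2 * Y / m) + 1)) := by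
    intro m hm
    refine Finset.card_image_le.trans (le_of_eq ?_)
    have hm0 : m ≠ 0 := by have := (Finset.mem_Icc.1 hm).1; omega
    simp only [T, Finset.card_product, Int.card_box hm0, Int.card_Icc]
    generalize M / m = p
    generalize 2 * Y / m = q
    congr 2 <;> omega
  refine le_trans ?_ (Finset.card_biUnion_le.trans (Finset.sum_le_sum hT))
  -- Sums and differences of the coordinates determine the pair, so it suffices to count the values
  -- of these four factors.
  refine Finset.card_le_card_of_injOn
    (fun x => (x.1.1 - x.2.1, x.1.1 + x.2.1, x.2.2 - x.1.2, x.2.2 + x.1.2)) ?_ ?_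
  · rintro ⟨⟨k1, k2⟩, l1, l2⟩ hx
    simp only [closePairs, Finset.coe_filter, Finset.mem_product, mem_square, Set.mem_ofPred_eq, ne_eq,
      Prod.mk.injEq, not_and_or] at hx
    obtain ⟨⟨⟨hk1, hk2⟩, hl1, hl2⟩, hne, heq, hd1, hd2⟩ := hx
    obtain ⟨d, a, b, t, hd, hab, e1, e2, e3, e4⟩ := mul_eq_mul_param
      (u := k1 - l1) (v := k1 + l1) (w := l2 - k2) (z := l2 + k2) (by linarith) (by omega)
    have hab0 : 0 < max a.natAbs b.natAbs := by
      rcases hab with h | h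
      · exact lt_max_of_lt_left (Int.natAbs_pos.2 h)
      · exact lt_max_of_lt_right (Int.natAbs_pos.2 h)
    obtain ⟨D, rfl⟩ := Int.eq_ofNat_of_zero_le hd.le
    have hM : D * max a.natAbs b.natAbs ≤ M := by
      have i1 : D * a.natAbs ≤ M := by
        have : (D * a).natAbs ≤ M := by rw [← e1]; have := abs_le.1 hd1; omega
        simpa [Int.natAbs_mul] using this
      have i2 : D * b.natAbs ≤ M := by
        have : (D * b).natAbs ≤ M := by rw [← e2]; have := abs_le.1 hd2; omega
        simpa [Int.natAbs_mul] using this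
      rcases max_choice a.natAbs b.natAbs with h | h <;> rw [h] <;> assumption
    have hY : t.natAbs * max a.natAbs b.natAbs ≤ 2 * Y := by
      have i1 : t.natAbs * a.natAbs ≤ 2 * Y := by
        have : (t * a).natAbs ≤ 2 * Y := by
          rw [mul_comm, ← e4]
          have := abs_le.1 hl2; have := abs_le.1 hk2
          omega
        simpa [Int.natAbs_mul] using this
      have i2 : t.natAbs * b.natAbs ≤ 2 * Y := by
        have : (t * b).natAbs ≤ 2 * Y := by
          rw [mul_comm, ← e3]
          have := abs_le.1 hl1; have := abs_le.1 hk1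
          omega
        simpa [Int.natAbs_mul] using this
      rcases max_choice a.natAbs b.natAbs with h | h <;> rw [h] <;> assumption
    have hD0 : 0 < D := by exact_mod_cast hd
    simp only [Finset.coe_biUnion, Set.mem_iUnion, Finset.coe_image, Set.mem_image, Finset.mem_coe]
    refine ⟨max a.natAbs b.natAbs, Finset.mem_Icc.2 ⟨hab0, (Nat.le_mul_of_pos_left _ hD0).trans hM⟩,
      ((a, b), (D : ℤ), t), ?_, ?_⟩
    · have j1 := (Nat.le_div_iff_mul_le hab0).2 hM
      have j2 := (Nat.le_div_iff_mul_le hab0).2 hY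
      simp only [T, Finset.mem_product, Int.mem_box, Finset.mem_Icc]
      refine ⟨trivial, ⟨by exact_mod_cast hD0, by exact_mod_cast j1⟩, ?_⟩
      generalize 2 * Y / max a.natAbs b.natAbs = q at *
      omega
    · simp only [F, e1, e2, e3, e4]
  · rintro ⟨⟨k1, k2⟩, l1, l2⟩ - ⟨⟨k1', k2'⟩, l1', l2'⟩ - h
    simp only [Prod.mk.injEq] at h ⊢
    omega

theorem card_closePairs_le {Y M : ℕ} (hM : M ≤ 2 * Y) :
    ((closePairs Y M).card : ℝ) ≤ 48 * M * Y * (1 + Real.log M) := by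
  have hlog : 0 ≤ Real.log M := Real.log_natCast_nonneg M
  have h1 : ((closePairs Y M).card : ℝ) ≤
      ∑ m ∈ Finset.Icc 1 M, (32 * M * Y * (m : ℝ)⁻¹ + 8 * M) := by
    refine (Nat.cast_le.2 (card_closePairs_le_sum Y M)).trans ?_
    push_cast
    refine Finset.sum_le_sum fun m hm => ?_
    have hm0 : (0 : ℝ) < m := by exact_mod_cast (Finset.mem_Icc.1 hm).1
    have i1 : ((M / m : ℕ) : ℝ) ≤ M / m := Nat.cast_div_le
    have i2 : ((2 * Y / m : ℕ) : ℝ) ≤ 2 * Y / m := by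
      have := Nat.cast_div_le (α := ℝ) (m := 2 * Y) (n := m)
      push_cast at this; exact this
    calc 8 * (m : ℝ) * ((M / m : ℕ) * (2 * (2 * Y / m : ℕ) + 1))
        ≤ 8 * (m : ℝ) * ((M / m) * (2 * (2 * Y / m) + 1)) := by gcongr
      _ = _ := by field_simp; ring
  have h2 : ∑ m ∈ Finset.Icc 1 M, ((m : ℝ)⁻¹) ≤ 1 + Real.log M := by
    have := harmonic_le_one_add_log M
    rw [harmonic_eq_sum_Icc] at this
    push_cast at this
    exact this
  rw [Finset.sum_add_distrib, ← Finset.mul_sum] at h1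
  simp only [Finset.sum_const, Nat.card_Icc, add_tsub_cancel_right, nsmul_eq_mul] at h1
  have h3 : (M : ℝ) ≤ 2 * Y := by exact_mod_cast hM
  calc _ ≤ _ := h1
    _ ≤ 32 * M * Y * (1 + Real.log M) + (2 * Y) * (8 * M) * (1 + Real.log M) := by
        refine add_le_add (by gcongr) ?_
        calc (M : ℝ) * (8 * M) ≤ (2 * Y) * (8 * M) * 1 := by rw [mul_one]; gcongr
          _ ≤ _ := by gcongr; linarith
    _ = _ := by ring

theorem circlePoints_subset_square {E N : ℕ} (h : E ≤ N) : circlePoints E ⊆ square N.sqrt := by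
  intro k hk
  rw [mem_circlePoints] at hk
  have aux : ∀ a b : ℤ, a ^ 2 + b ^ 2 = E → |a| ≤ N.sqrt := by
    intro a b hab
    have h1 : a.natAbs ≤ N.sqrt := by
      rw [Nat.le_sqrt']
      have : ((a.natAbs ^ 2 : ℕ) : ℤ) ≤ N := by
        push_cast
        rw [sq_abs]
        have : (E : ℤ) ≤ N := by exact_mod_cast h
        nlinarith [sq_nonneg b]
      exact_mod_cast this
    rw [Int.abs_eq_natAbs]
    exact_mod_cast h1
  exact mem_square.2 ⟨aux _ _ hk, aux _ k.1 (by rw [add_comm]; exact hk)⟩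

theorem circlePoints_nonempty_iff {E : ℕ} : (circlePoints E).Nonempty ↔ E ∈ laplaceSpectrum := by
  constructor
  · rintro ⟨k, hk⟩
    exact ⟨k.1, k.2, (mem_circlePoints.1 hk).symm⟩
  · rintro ⟨a, b, h⟩
    exact ⟨(a, b), mem_circlePoints.2 h.symm⟩

/-! ### Moments of the representation numbers and density of the good spectrum -/

/-- The logarithmic factor in the counting estimates. -/
def logFactor (N : ℕ) : ℝ := 1 + Real.log (2 * N)

theorem one_le_logFactor {N : ℕ} (hN : 1 ≤ N) : 1 ≤ logFactor N := by
  have : (1 : ℝ) ≤ N := by exact_mod_cast hN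
  have := Real.log_nonneg (by linarith : (1 : ℝ) ≤ 2 * N)
  unfold logFactor; linarith

theorem log_le_logFactor {M N : ℕ} (h : M ≤ 2 * N) (hN : 1 ≤ N) : 1 + Real.log M ≤ logFactor N := by
  unfold logFactor
  rcases Nat.eq_zero_or_pos M with rfl | hM
  · have := one_le_logFactor hN
    unfold logFactor at this
    simpa using this
  · have : (0 : ℝ) < M := by exact_mod_cast hM
    gcongr
    exact_mod_cast h

theorem sqrt_cast_sq_le (N : ℕ) : ((N.sqrt : ℕ) : ℝ) ^ 2 ≤ N := by exact_mod_cast Nat.sqrt_le' N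

/-- Second moment of the number of representations as a sum of two squares. -/
theorem sum_card_sq_le {N : ℕ} (hN : 1 ≤ N) :
    ∑ E ∈ Finset.range (N + 1), ((circlePoints E).card : ℝ) ^ 2 ≤ 105 * N * logFactor N := by
  classical
  set Y := N.sqrt with hY
  have hY1 : 1 ≤ Y := Nat.le_sqrt'.2 (by simpa using hN)
  -- The second moment counts ordered pairs on a common circle: the diagonal, plus distinct pairs,
  -- for which the distance bound `2 * Y` holds automatically in the square.
  have h1 : ∑ E ∈ Finset.range (N + 1), (circlePoints E).card ^ 2 ≤
      (square Y).card + (closePairs Y (2 * Y)).card := by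
    have hd : (Finset.range (N + 1) : Set ℕ).PairwiseDisjoint
        fun E => circlePoints E ×ˢ circlePoints E := by
      intro E _ F _ hEF
      rw [Function.onFun, Finset.disjoint_left]
      intro x hx hx'
      have a1 := mem_circlePoints.1 (Finset.mem_product.1 hx).1
      have a2 := mem_circlePoints.1 (Finset.mem_product.1 hx').1
      exact hEF (by exact_mod_cast a1.symm.trans a2)
    have : ∑ E ∈ Finset.range (N + 1), (circlePoints E).card ^ 2 =
        ((Finset.range (N + 1)).biUnion fun E => circlePoints E ×ˢ circlePoints E).card := by
      rw [Finset.card_biUnion hd]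
      exact Finset.sum_congr rfl fun E _ => by rw [Finset.card_product, sq]
    rw [this, ← Finset.diag_card (square Y)]
    refine (Finset.card_le_card ?_).trans (Finset.card_union_le _ _)
    rintro ⟨k, l⟩ hx
    simp only [Finset.mem_biUnion, Finset.mem_range, Finset.mem_product] at hx
    obtain ⟨E, hE, hk, hl⟩ := hx
    have hks := circlePoints_subset_square (Nat.lt_succ_iff.1 hE) hk
    have hls := circlePoints_subset_square (Nat.lt_succ_iff.1 hE) hl
    rw [mem_circlePoints] at hk hl
    rw [Finset.mem_union]
    by_cases hkl : k = l
    · left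
      rw [Finset.mem_diag]
      exact ⟨hks, hkl⟩
    · right
      simp only [closePairs, Finset.mem_filter, Finset.mem_product]
      refine ⟨⟨hks, hls⟩, hkl, hk.trans hl.symm, ?_⟩
      rw [mem_square] at hks hls
      have b1 := abs_le.1 hks.1
      have b2 := abs_le.1 hks.2
      have b3 := abs_le.1 hls.1
      have b4 := abs_le.1 hls.2
      rw [← hY] at *
      constructor <;> rw [abs_le] <;> constructor <;> push_cast <;> linarith
  have h2 := card_closePairs_le (le_refl (2 * Y))
  have h3 : (Y : ℝ) ^ 2 ≤ N := sqrt_cast_sq_le N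
  have hYN : Y ≤ N := Nat.sqrt_le_self N
  have h4 : 1 + Real.log (2 * Y : ℕ) ≤ logFactor N := log_le_logFactor (by omega) hN
  have h5 : (1 : ℝ) ≤ Y := by exact_mod_cast hY1
  have h6 := one_le_logFactor hN
  rw [card_square] at h1
  have h7 : (∑ E ∈ Finset.range (N + 1), ((circlePoints E).card : ℝ) ^ 2) ≤
      (2 * Y + 1) ^ 2 + (closePairs Y (2 * Y)).card := by exact_mod_cast h1
  calc _ ≤ _ := h7
    _ ≤ 9 * (Y : ℝ) ^ 2 * 1 + 48 * (2 * Y : ℕ) * Y * (1 + Real.log (2 * Y : ℕ)) := by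
        refine add_le_add (by nlinarith) h2
    _ ≤ 9 * (Y : ℝ) ^ 2 * logFactor N + 48 * (2 * Y : ℕ) * Y * logFactor N := by gcongr
    _ = 105 * (Y : ℝ) ^ 2 * logFactor N := by push_cast; ring
    _ ≤ _ := by gcongr

/-- The disc of radius `√N` contains the square of half-side `√(N / 2)`. -/
theorem half_le_sum_card (N : ℕ) :
    (N : ℝ) / 2 ≤ ∑ E ∈ Finset.range (N + 1), ((circlePoints E).card : ℝ) := by
  classical
  set Y := (N / 2).sqrt with hY
  have h1 : (square Y).card ≤ ∑ E ∈ Finset.range (N + 1), (circlePoints E).card := by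
    refine (Finset.card_le_card ?_).trans Finset.card_biUnion_le
    intro k hk
    rw [mem_square] at hk
    have hY2 : Y ^ 2 ≤ N / 2 := Nat.sqrt_le' _
    have hY3 : (Y : ℤ) ^ 2 * 2 ≤ N := by
      have : Y ^ 2 * 2 ≤ N := by omega
      exact_mod_cast this
    have e1 : k.1 ^ 2 ≤ (Y : ℤ) ^ 2 := sq_le_sq' (by linarith [abs_le.1 hk.1]) (abs_le.1 hk.1).2
    have e2 : k.2 ^ 2 ≤ (Y : ℤ) ^ 2 := sq_le_sq' (by linarith [abs_le.1 hk.2]) (abs_le.1 hk.2).2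
    obtain ⟨E, hE⟩ := Int.eq_ofNat_of_zero_le (by positivity : 0 ≤ k.1 ^ 2 + k.2 ^ 2)
    rw [Finset.mem_biUnion]
    refine ⟨E, Finset.mem_range.2 ?_, mem_circlePoints.2 hE⟩
    have : (E : ℤ) ≤ N := by linarith
    have : E ≤ N := by exact_mod_cast this
    omega
  rw [card_square] at h1
  have h2 : N / 2 < (Y + 1) ^ 2 := Nat.lt_succ_sqrt' _
  have h3 : N ≤ 2 * (2 * Y + 1) ^ 2 := by
    have : (Y + 1) ^ 2 ≤ (2 * Y + 1) ^ 2 := Nat.pow_le_pow_left (by omega) 2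
    omega
  have h4 : (N : ℝ) ≤ 2 * ∑ E ∈ Finset.range (N + 1), ((circlePoints E).card : ℝ) := by
    have : N ≤ 2 * ∑ E ∈ Finset.range (N + 1), (circlePoints E).card := by omega
    exact_mod_cast this
  linarith

open scoped Classical in
/-- Elements of `A` up to `N`, as a finite set. -/
def upTo (A : Set ℕ) (N : ℕ) : Finset ℕ := (Finset.range (N + 1)).filter (· ∈ A)

theorem mem_upTo {A : Set ℕ} {N E : ℕ} : E ∈ upTo A N ↔ E ≤ N ∧ E ∈ A := by
  simp [upTo]

theorem ncard_inter_Iic (A : Set ℕ) (N : ℕ) : (A ∩ Set.Iic N).ncard = (upTo A N).card := by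
  rw [← Set.ncard_coe_finset]
  congr 1
  ext E
  simp [mem_upTo, and_comm]

/-- There are at least `c N / log N` sums of two squares up to `N`. -/
theorem le_card_laplaceSpectrum {N : ℕ} (hN : 1 ≤ N) :
    (N : ℝ) ≤ 420 * logFactor N * (upTo laplaceSpectrum N).card := by
  classical
  have hsupp : ∑ E ∈ upTo laplaceSpectrum N, ((circlePoints E).card : ℝ) =
      ∑ E ∈ Finset.range (N + 1), ((circlePoints E).card : ℝ) := by
    apply Finset.sum_subset (Finset.filter_subset _ _)
    intro E hE hE'
    have : E ∉ laplaceSpectrum := fun h => hE' (mem_upTo.2 ⟨Nat.lt_succ_iff.1 (Finset.mem_range.1 hE), h⟩)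
    rw [← circlePoints_nonempty_iff, Finset.not_nonempty_iff_eq_empty] at this
    simp [this]
  have h1 := sq_sum_le_card_mul_sum_sq (s := upTo laplaceSpectrum N)
    (f := fun E => ((circlePoints E).card : ℝ))
  rw [hsupp] at h1
  have h2 : ∑ E ∈ upTo laplaceSpectrum N, ((circlePoints E).card : ℝ) ^ 2 ≤ 105 * N * logFactor N :=
    (Finset.sum_le_sum_of_subset_of_nonneg (Finset.filter_subset _ _)
      fun _ _ _ => by positivity).trans (sum_card_sq_le hN)
  have h3 := half_le_sum_card N
  have hNp : (0 : ℝ) < N := by exact_mod_cast hN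
  have h4 : ((N : ℝ) / 2) ^ 2 ≤ (upTo laplaceSpectrum N).card * (105 * N * logFactor N) :=
    (pow_le_pow_left₀ (by positivity) h3 2).trans (h1.trans (by gcongr))
  have h5 : (N : ℝ) * N ≤ N * (420 * logFactor N * (upTo laplaceSpectrum N).card) := by
    linarith
  exact le_of_mul_le_mul_left h5 hNp

/-- The sums of two squares whose circle has few integer points, all of them far apart. -/
def goodSpectrum : Set ℕ :=
  {E | E ∈ laplaceSpectrum ∧
    (∀ k ∈ circlePoints E, ∀ l ∈ circlePoints E, k ≠ l →
      (E : ℤ) < |k.1 - l.1| ^ 4 ∨ (E : ℤ) < |k.2 - l.2| ^ 4) ∧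
    (circlePoints E).card ^ 32 ≤ E}

/-- An exception either carries a close pair, at distance at most `M ≤ N^(1/4)`, or is at most `√N`,
or has more than `N^(1/64)` representations. The last kind is controlled by Chebyshev with the
second moment, and this gives the exponent `1 - 1/32`. -/
theorem card_exceptional_le {N : ℕ} (hN : 1 ≤ N) :
    ((upTo (laplaceSpectrum \ goodSpectrum) N).card : ℝ) ≤
      200 * (N : ℝ) ^ (31 / 32 : ℝ) * logFactor N := by
  classical
  set Y := N.sqrt with hY
  set M := Y.sqrt with hM
  have hY1 : 1 ≤ Y := Nat.le_sqrt'.2 (by simpa using hN)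
  have hYN : Y ≤ N := Nat.sqrt_le_self N
  have hMY : M ≤ Y := Nat.sqrt_le_self Y
  have hN1 : (1 : ℝ) ≤ N := by exact_mod_cast hN
  have hL := one_le_logFactor hN
  set B := (Finset.range (N + 1)).filter fun E => N < (circlePoints E).card ^ 64 with hB
  have hcover : upTo (laplaceSpectrum \ goodSpectrum) N ⊆
      (closePairs Y M).image (fun x => (x.1.1 ^ 2 + x.1.2 ^ 2).toNat) ∪ (Finset.range (Y + 1) ∪ B) := by
    intro E hE
    rw [mem_upTo] at hE
    obtain ⟨hEN, hEA, hES⟩ := hE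
    rw [Finset.mem_union, Finset.mem_union]
    by_cases h1 : ∃ k ∈ circlePoints E, ∃ l ∈ circlePoints E, k ≠ l ∧
      |k.1 - l.1| ^ 4 ≤ (E : ℤ) ∧ |k.2 - l.2| ^ 4 ≤ (E : ℤ)
    · left
      obtain ⟨k, hk, l, hl, hkl, h1, h2⟩ := h1
      have hb : ∀ z : ℤ, |z| ^ 4 ≤ (E : ℤ) → |z| ≤ M := by
        intro z hz
        rw [Int.abs_eq_natAbs] at hz ⊢
        have hz' : z.natAbs ^ 4 ≤ N := le_trans (by exact_mod_cast hz) hEN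
        have : z.natAbs ≤ M := by
          rw [hM, hY, Nat.le_sqrt', Nat.le_sqrt']
          calc _ = z.natAbs ^ 4 := by ring
            _ ≤ N := hz'
        exact_mod_cast this
      refine Finset.mem_image.2 ⟨(k, l), ?_, ?_⟩
      · simp only [closePairs, Finset.mem_filter, Finset.mem_product]
        exact ⟨⟨circlePoints_subset_square hEN hk, circlePoints_subset_square hEN hl⟩, hkl,
          (mem_circlePoints.1 hk).trans (mem_circlePoints.1 hl).symm, hb _ h1, hb _ h2⟩
      · simp only [mem_circlePoints.1 hk, Int.toNat_natCast]
    · right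
      -- Discarding `E ≤ √N` turns the bound by a power of `E` into one by a power of `N`, at the
      -- price of squaring: `N < (Y + 1)² ≤ E²`.
      by_cases h2 : E ≤ Y
      · left; exact Finset.mem_range.2 (by omega)
      · right
        rw [hB, Finset.mem_filter]
        refine ⟨Finset.mem_range.2 (by omega), ?_⟩
        have h3 : E < (circlePoints E).card ^ 32 := by
          by_contra h3
          refine hES ⟨hEA, fun k hk l hl hkl => ?_, not_lt.1 h3⟩
          by_contra h4
          rw [not_or, not_lt, not_lt] at h4
          exact h1 ⟨k, hk, l, hl, hkl, h4⟩
        calc N < (Y + 1) ^ 2 := Nat.lt_succ_sqrt' N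
          _ ≤ ((circlePoints E).card ^ 32) ^ 2 := Nat.pow_le_pow_left (by omega) 2
          _ = _ := by ring
  have hcard : ((upTo (laplaceSpectrum \ goodSpectrum) N).card : ℝ) ≤
      (closePairs Y M).card + ((Y + 1) + B.card) := by
    have h1 := (Finset.card_le_card hcover).trans ((Finset.card_union_le _ _).trans
      (add_le_add Finset.card_image_le (Finset.card_union_le _ _)))
    rw [Finset.card_range] at h1
    exact_mod_cast h1
  have hYr : (Y : ℝ) ≤ (N : ℝ) ^ (1 / 2 : ℝ) := by
    rw [← Real.sqrt_eq_rpow]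
    exact Real.le_sqrt_of_sq_le (sqrt_cast_sq_le N)
  have hMr : (M : ℝ) ≤ (N : ℝ) ^ (1 / 4 : ℝ) := by
    have : (M : ℝ) ≤ (Y : ℝ) ^ (1 / 2 : ℝ) := by
      rw [← Real.sqrt_eq_rpow]
      exact Real.le_sqrt_of_sq_le (sqrt_cast_sq_le Y)
    refine this.trans ((Real.rpow_le_rpow (by positivity) hYr (by norm_num)).trans (le_of_eq ?_))
    rw [← Real.rpow_mul (by positivity)]
    norm_num
  have hexp : ∀ {s : ℝ}, s ≤ 31 / 32 → (N : ℝ) ^ s ≤ (N : ℝ) ^ (31 / 32 : ℝ) :=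
    fun hs => Real.rpow_le_rpow_of_exponent_le hN1 hs
  set Q := (N : ℝ) ^ (31 / 32 : ℝ) with hQ
  have hQ1 : 1 ≤ Q := Real.one_le_rpow hN1 (by norm_num)
  have p1 : ((closePairs Y M).card : ℝ) ≤ 48 * Q * logFactor N := by
    have hMYr : (M : ℝ) * Y ≤ Q := by
      calc (M : ℝ) * Y ≤ (N : ℝ) ^ (1 / 4 : ℝ) * (N : ℝ) ^ (1 / 2 : ℝ) := by gcongr
        _ = (N : ℝ) ^ (1 / 4 + 1 / 2 : ℝ) := (Real.rpow_add (by positivity) _ _).symm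
        _ ≤ Q := hexp (by norm_num)
    calc _ ≤ 48 * (M : ℝ) * Y * (1 + Real.log M) := card_closePairs_le (by omega)
      _ ≤ 48 * (M : ℝ) * Y * logFactor N := by
          gcongr; exact log_le_logFactor (by omega) hN
      _ = 48 * (M * Y) * logFactor N := by ring
      _ ≤ _ := by gcongr
  have p2 : (Y : ℝ) + 1 ≤ 2 * Q * logFactor N := by
    have : (Y : ℝ) ≤ Q := hYr.trans (hexp (by norm_num))
    nlinarith
  have p3 : (B.card : ℝ) ≤ 105 * Q * logFactor N := by
    have hR : ∀ E ∈ B, (N : ℝ) ^ (1 / 32 : ℝ) ≤ ((circlePoints E).card : ℝ) ^ 2 := by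
      intro E hE
      have h1 : (N : ℝ) ≤ ((circlePoints E).card : ℝ) ^ 64 := by
        exact_mod_cast (Finset.mem_filter.1 hE).2.le
      calc (N : ℝ) ^ (1 / 32 : ℝ) ≤ (((circlePoints E).card : ℝ) ^ 64) ^ (1 / 32 : ℝ) := by gcongr
        _ = _ := by
          rw [← Real.rpow_natCast, ← Real.rpow_mul (by positivity), ← Real.rpow_natCast]
          norm_num
    have h1 : (B.card : ℝ) * (N : ℝ) ^ (1 / 32 : ℝ) ≤ 105 * N * logFactor N := by
      calc _ = ∑ E ∈ B, (N : ℝ) ^ (1 / 32 : ℝ) := by rw [Finset.sum_const, nsmul_eq_mul]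
        _ ≤ ∑ E ∈ B, ((circlePoints E).card : ℝ) ^ 2 := Finset.sum_le_sum hR
        _ ≤ ∑ E ∈ Finset.range (N + 1), ((circlePoints E).card : ℝ) ^ 2 :=
            Finset.sum_le_sum_of_subset_of_nonneg (Finset.filter_subset _ _) fun _ _ _ => by positivity
        _ ≤ _ := sum_card_sq_le hN
    have h2 : (N : ℝ) = Q * (N : ℝ) ^ (1 / 32 : ℝ) := by
      rw [hQ, ← Real.rpow_add (by positivity)]
      norm_num
    have h3 : (B.card : ℝ) * (N : ℝ) ^ (1 / 32 : ℝ) ≤ (105 * Q * logFactor N) * (N : ℝ) ^ (1 / 32 : ℝ) := by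
      refine h1.trans (le_of_eq ?_)
      conv_lhs => rw [h2]
      ring
    exact le_of_mul_le_mul_right h3 (by positivity)
  nlinarith

theorem isDensityOneSubset_goodSpectrum : IsDensityOneSubset goodSpectrum laplaceSpectrum := by
  classical
  refine ⟨fun E hE => hE.1, ?_⟩
  have hlim : Tendsto (fun N : ℕ => 84000 * ((N : ℝ) ^ (-(1 / 32) : ℝ) * logFactor N ^ 2)) atTop (𝓝 0) := by
    have h1 : Tendsto (fun x : ℝ => x ^ (-(1 / 32) : ℝ) * (1 + Real.log (2 * x)) ^ 2) atTop (𝓝 0) := by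
      have h2 : Tendsto (fun x : ℝ => x ^ (-(1 / 64) : ℝ) * (1 + Real.log (2 * x))) atTop (𝓝 0) := by
        have e : (fun x : ℝ => (1 + Real.log 2) * x ^ (-(1 / 64) : ℝ) + Real.log x / x ^ (1 / 64 : ℝ))
            =ᶠ[atTop] fun x : ℝ => x ^ (-(1 / 64) : ℝ) * (1 + Real.log (2 * x)) := by
          filter_upwards [eventually_gt_atTop 0] with x hx
          rw [Real.log_mul (by norm_num) hx.ne', Real.rpow_neg hx.le]
          ring
        refine Tendsto.congr' e ?_
        have t1 := (tendsto_rpow_neg_atTop (by norm_num : (0 : ℝ) < 1 / 64)).const_mul (1 + Real.log 2)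
        have t2 := (isLittleO_log_rpow_atTop (by norm_num : (0 : ℝ) < 1 / 64)).tendsto_div_nhds_zero
        simpa using t1.add t2
      have h3 := h2.pow 2
      rw [zero_pow two_ne_zero] at h3
      refine h3.congr' ?_
      filter_upwards [eventually_gt_atTop 0] with x hx
      rw [mul_pow, ← Real.rpow_natCast (x ^ (-(1 / 64) : ℝ)), ← Real.rpow_mul hx.le]
      norm_num
    have h4 := (h1.comp tendsto_natCast_atTop_atTop).const_mul 84000
    rw [mul_zero] at h4
    exact h4
  have hone : Tendsto (fun N : ℕ => 1 - 84000 * ((N : ℝ) ^ (-(1 / 32) : ℝ) * logFactor N ^ 2)) atTop (𝓝 1) := by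
    simpa using hlim.const_sub 1
  refine tendsto_of_tendsto_of_tendsto_of_le_of_le' hone tendsto_const_nhds ?_ ?_
  · filter_upwards [eventually_ge_atTop 1] with N hN
    rw [ncard_inter_Iic, ncard_inter_Iic]
    have hNp : (0 : ℝ) < N := by exact_mod_cast hN
    have hL := one_le_logFactor hN
    have h1 := le_card_laplaceSpectrum hN
    have h2 := card_exceptional_le hN
    have h3 : upTo laplaceSpectrum N = upTo goodSpectrum N ∪ upTo (laplaceSpectrum \ goodSpectrum) N := by
      ext E
      simp only [Finset.mem_union, mem_upTo, Set.mem_sdiff]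
      constructor
      · rintro ⟨a, b⟩
        by_cases h : E ∈ goodSpectrum
        · exact Or.inl ⟨a, h⟩
        · exact Or.inr ⟨a, b, h⟩
      · rintro (⟨a, b⟩ | ⟨a, b, c⟩)
        · exact ⟨a, b.1⟩
        · exact ⟨a, b⟩
    have h4 : ((upTo laplaceSpectrum N).card : ℝ) ≤ (upTo goodSpectrum N).card +
        (upTo (laplaceSpectrum \ goodSpectrum) N).card := by
      rw [h3]; exact_mod_cast Finset.card_union_le _ _
    have hApos : (0 : ℝ) < (upTo laplaceSpectrum N).card := by
      by_contra h
      have : ((upTo laplaceSpectrum N).card : ℝ) = 0 := le_antisymm (not_lt.1 h) (by positivity)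
      rw [this, mul_zero] at h1
      linarith
    rw [le_div_iff₀ hApos]
    -- Here `84000 = 200 * 420`: the bound for the exceptions is compared with the lower bound for
    -- all sums of two squares.
    have h5 : 200 * (N : ℝ) ^ (31 / 32 : ℝ) * logFactor N ≤
        84000 * ((N : ℝ) ^ (-(1 / 32) : ℝ) * logFactor N ^ 2) * (upTo laplaceSpectrum N).card := by
      have e : (N : ℝ) ^ (31 / 32 : ℝ) = (N : ℝ) ^ (-(1 / 32) : ℝ) * N := by
        conv_rhs => rw [← Real.rpow_add_one hNp.ne']
        norm_num
      rw [e]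
      calc 200 * ((N : ℝ) ^ (-(1 / 32) : ℝ) * N) * logFactor N
          ≤ 200 * ((N : ℝ) ^ (-(1 / 32) : ℝ) * (420 * logFactor N * (upTo laplaceSpectrum N).card))
            * logFactor N := by gcongr
        _ = _ := by ring
    linarith
  · refine Eventually.of_forall fun N => ?_
    rw [ncard_inter_Iic, ncard_inter_Iic]
    apply div_le_one_of_le₀ _ (by positivity)
    have : upTo goodSpectrum N ⊆ upTo laplaceSpectrum N := fun E hE =>
      mem_upTo.2 ⟨(mem_upTo.1 hE).1, (mem_upTo.1 hE).2.1⟩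
    exact_mod_cast Finset.card_le_card this

/-! ### Convergence of `|u|² σ` along the good spectrum -/

theorem norm_sum_sum_le {ι : Type*} (s : Finset ι) (c : ι → ℂ) (m : ι → ι → ℂ) {δ : ℝ}
    (hc : ∑ k ∈ s, ‖c k‖ ^ 2 = 1) (hδ : 0 ≤ δ) (hm : ∀ k ∈ s, ∀ l ∈ s, ‖m k l‖ ≤ δ) :
    ‖∑ k ∈ s, ∑ l ∈ s, c k * (starRingEnd ℂ) (c l) * m k l‖ ≤ s.card * δ := by
  have h1 : ‖∑ k ∈ s, ∑ l ∈ s, c k * (starRingEnd ℂ) (c l) * m k l‖ ≤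
      ∑ k ∈ s, ∑ l ∈ s, ‖c k‖ * ‖c l‖ * δ := by
    refine norm_sum_le_of_le _ fun k hk => norm_sum_le_of_le _ fun l hl => ?_
    rw [norm_mul, norm_mul, RCLike.norm_conj]
    exact mul_le_mul_of_nonneg_left (hm k hk l hl) (by positivity)
  have h2 : ∑ k ∈ s, ∑ l ∈ s, ‖c k‖ * ‖c l‖ * δ = (∑ k ∈ s, ‖c k‖) ^ 2 * δ := by
    simp_rw [← Finset.sum_mul, ← Finset.mul_sum, ← Finset.sum_mul, sq]
  have h3 := sq_sum_le_card_mul_sum_sq (s := s) (f := fun k => ‖c k‖)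
  rw [hc, mul_one] at h3
  rw [h2] at h1
  exact h1.trans (mul_le_mul_of_nonneg_right h3 hδ)

/-- The Fourier coefficients of `|u|² σ` and of `σ` are close when those of `σ` at the differences of
the frequencies of `u` are small. -/
theorem norm_integral_character_sub_le {ν : Measure Torus} [IsFiniteMeasure ν] {u : C(Torus, ℂ)}
    {lam : ℝ} {E : ℕ} (h : IsNormalizedEigenfunction u lam) (hE : lam ^ 2 = E) (j : ℤ × ℤ) {δ : ℝ}
    (hδ : 0 ≤ δ) (hν : ∀ k ∈ circlePoints E, ∀ l ∈ circlePoints E, k ≠ l →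
      ‖∫ x, character (k - l + j) x ∂ν‖ ≤ δ) :
    ‖(∫ x, character j x * ((‖u x‖ ^ 2 : ℝ) : ℂ) ∂ν) - ∫ x, character j x ∂ν‖ ≤
      (circlePoints E).card * δ := by
  classical
  have hx := h.expansion hE
  have hc := h.sum_sq_coeff hE
  have e : ∀ x, character j x * ((‖u x‖ ^ 2 : ℝ) : ℂ) = ∑ k ∈ circlePoints E, ∑ l ∈ circlePoints E,
      coeff u k * (starRingEnd ℂ) (coeff u l) * character (k - l + j) x := by
    intro x
    have hx' : u x = ∑ k ∈ circlePoints E, coeff u k * character k x := by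
      conv_lhs => rw [hx]
      simp [ContinuousMap.sum_apply]
    have e1 : ((‖u x‖ ^ 2 : ℝ) : ℂ) = u x * (starRingEnd ℂ) (u x) := by
      rw [Complex.mul_conj']; push_cast; rfl
    rw [e1, hx', map_sum, Finset.sum_mul_sum, Finset.mul_sum]
    refine Finset.sum_congr rfl fun k _ => ?_
    rw [Finset.mul_sum]
    refine Finset.sum_congr rfl fun l _ => ?_
    rw [character_add, sub_eq_add_neg, character_add, character_neg, map_mul]
    ring
  have e2 : ∫ x, character j x * ((‖u x‖ ^ 2 : ℝ) : ℂ) ∂ν =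
      ∑ k ∈ circlePoints E, ∑ l ∈ circlePoints E,
        coeff u k * (starRingEnd ℂ) (coeff u l) * ∫ x, character (k - l + j) x ∂ν := by
    simp_rw [e]
    rw [integral_finsetSum _ fun k _ => integrable_finsetSum _ fun l _ =>
      (integrable_continuousMap (character (k - l + j))).const_mul _]
    refine Finset.sum_congr rfl fun k _ => ?_
    rw [integral_finsetSum _ fun l _ =>
      (integrable_continuousMap (character (k - l + j))).const_mul _]
    exact Finset.sum_congr rfl fun l _ => integral_const_mul _ _
  -- The normalization of the coefficients writes the limit as a diagonal double sum, so that it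
  -- cancels the terms `k = l` exactly.
  have e3 : ∫ x, character j x ∂ν = ∑ k ∈ circlePoints E, ∑ l ∈ circlePoints E,
      coeff u k * (starRingEnd ℂ) (coeff u l) * (if k = l then ∫ x, character j x ∂ν else 0) := by
    simp_rw [mul_ite, mul_zero]
    have : ∀ k ∈ circlePoints E, (∑ l ∈ circlePoints E, if k = l then
        coeff u k * (starRingEnd ℂ) (coeff u l) * ∫ x, character j x ∂ν else 0) =
        ((‖coeff u k‖ ^ 2 : ℝ) : ℂ) * ∫ x, character j x ∂ν := by
      intro k hk
      rw [Finset.sum_ite_eq, if_pos hk, Complex.mul_conj']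
      push_cast; rfl
    rw [Finset.sum_congr rfl this, ← Finset.sum_mul, ← Complex.ofReal_sum, hc]
    simp
  rw [e2, e3]
  simp_rw [← Finset.sum_sub_distrib, ← mul_sub]
  apply norm_sum_sum_le _ _ _ hc hδ
  intro k hk l hl
  by_cases hkl : k = l
  · subst hkl
    simpa using hδ
  · rw [if_neg hkl, sub_zero]
    exact hν k hk l hl hkl

/-- The decay rate of Fourier coefficients at shifted differences of points on a good circle. -/
theorem decay_at_differences {ν : Measure Torus} {B : ℝ} (hB : 0 ≤ B)
    (hdecay : ∀ (k : ℤ × ℤ) (μ : ℝ), 1 ≤ μ → (k.1 : ℝ) ^ 2 + (k.2 : ℝ) ^ 2 = (μ ^ 3) ^ 2 →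
      ‖∫ x, character k x ∂ν‖ ≤ B / μ) {E : ℕ} (hE : E ∈ goodSpectrum) {j : ℤ × ℤ}
    (h2 : 2 ≤ (E : ℝ) ^ (1 / 4 : ℝ)) (h0 : 2 * |(j.1 : ℝ)| ≤ (E : ℝ) ^ (1 / 4 : ℝ))
    (h1 : 2 * |(j.2 : ℝ)| ≤ (E : ℝ) ^ (1 / 4 : ℝ))
    {k l : ℤ × ℤ} (hk : k ∈ circlePoints E) (hl : l ∈ circlePoints E) (hkl : k ≠ l) :
    ‖∫ x, character (k - l + j) x ∂ν‖ ≤ 2 * B * (E : ℝ) ^ (-(1 / 12) : ℝ) := by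
  set R := (E : ℝ) ^ (1 / 4 : ℝ) with hR
  have hE0 : (0 : ℝ) < E := by
    rcases Nat.eq_zero_or_pos E with h | h
    · rw [hR, h, Nat.cast_zero, Real.zero_rpow (by norm_num)] at h2
      linarith
    · exact_mod_cast h
  have hR0 : 0 < R := by linarith
  have key : ∀ z w : ℤ, (E : ℤ) < |z| ^ 4 → 2 * |(w : ℝ)| ≤ R → (R / 2) ^ 2 ≤ ((z + w : ℤ) : ℝ) ^ 2 := by
    intro z w hz hw
    have hz' : (E : ℝ) < |(z : ℝ)| ^ 4 := by exact_mod_cast hz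
    have hz2 : R ≤ |(z : ℝ)| := by
      calc R ≤ (|(z : ℝ)| ^ 4) ^ (1 / 4 : ℝ) := Real.rpow_le_rpow hE0.le hz'.le (by norm_num)
        _ = |(z : ℝ)| := by
          rw [← Real.rpow_natCast, ← Real.rpow_mul (abs_nonneg _)]
          norm_num
    -- A fixed shift `j` costs at most half of the separation once `E^(1/4) ≥ 2 |j|` coordinatewise.
    have h3 : R / 2 ≤ |(z : ℝ) + w| := by
      have := abs_sub_abs_le_abs_sub (z : ℝ) (-w)
      rw [abs_neg, sub_neg_eq_add] at this
      linarith
    rw [← sq_abs ((z + w : ℤ) : ℝ)]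
    push_cast
    exact pow_le_pow_left₀ (by positivity) h3 2
  set m := k - l + j with hm
  set s : ℝ := (m.1 : ℝ) ^ 2 + (m.2 : ℝ) ^ 2 with hs
  have hs1 : (R / 2) ^ 2 ≤ s := by
    rcases hE.2.1 k hk l hl hkl with h | h
    · have := key _ _ h h0
      have e : m.1 = k.1 - l.1 + j.1 := rfl
      rw [← e] at this
      linarith [sq_nonneg (m.2 : ℝ)]
    · have := key _ _ h h1
      have e : m.2 = k.2 - l.2 + j.2 := rfl
      rw [← e] at this
      linarith [sq_nonneg (m.1 : ℝ)]
  have hs0 : 0 ≤ s := by positivity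
  -- The decay hypothesis is stated for frequencies of length `μ³`, and `s` is the squared length.
  -- The assumption `R ≥ 2` ensures `μ ≥ 1`.
  set μ := s ^ (1 / 6 : ℝ) with hμ
  have hμ6 : (μ ^ 3) ^ 2 = s := by
    rw [hμ, ← Real.rpow_natCast, ← Real.rpow_natCast, ← Real.rpow_mul hs0, ← Real.rpow_mul hs0]
    norm_num
  have hle : (E : ℝ) ^ (1 / 12 : ℝ) / 2 ≤ μ := by
    have e1 : ((R / 2) ^ 2) ^ (1 / 6 : ℝ) = (E : ℝ) ^ (1 / 12 : ℝ) / 2 ^ (1 / 3 : ℝ) := by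
      rw [← Real.rpow_natCast, ← Real.rpow_mul (by positivity), Real.div_rpow hR0.le (by norm_num), hR,
        ← Real.rpow_mul hE0.le]
      norm_num
    have e2 : (2 : ℝ) ^ (1 / 3 : ℝ) ≤ 2 := by
      calc (2 : ℝ) ^ (1 / 3 : ℝ) ≤ 2 ^ (1 : ℝ) :=
            Real.rpow_le_rpow_of_exponent_le (by norm_num) (by norm_num)
        _ = 2 := Real.rpow_one 2
    calc (E : ℝ) ^ (1 / 12 : ℝ) / 2 ≤ (E : ℝ) ^ (1 / 12 : ℝ) / 2 ^ (1 / 3 : ℝ) := by gcongr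
      _ = ((R / 2) ^ 2) ^ (1 / 6 : ℝ) := e1.symm
      _ ≤ μ := Real.rpow_le_rpow (by positivity) hs1 (by norm_num)
  have hμ1 : 1 ≤ μ := by
    apply Real.one_le_rpow _ (by norm_num)
    nlinarith
  refine (hdecay m μ hμ1 hμ6.symm).trans ?_
  have hEp : 0 < (E : ℝ) ^ (1 / 12 : ℝ) := by positivity
  calc B / μ ≤ B / ((E : ℝ) ^ (1 / 12 : ℝ) / 2) := by gcongr
    _ = 2 * B * (E : ℝ) ^ (-(1 / 12) : ℝ) := by
      rw [Real.rpow_neg hE0.le]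
      field_simp

theorem tendsto_integral_character {ν : Measure Torus} [IsFiniteMeasure ν] {B : ℝ} (hB : 0 ≤ B)
    (hdecay : ∀ (k : ℤ × ℤ) (μ : ℝ), 1 ≤ μ → (k.1 : ℝ) ^ 2 + (k.2 : ℝ) ^ 2 = (μ ^ 3) ^ 2 →
      ‖∫ x, character k x ∂ν‖ ≤ B / μ) {lam : ℕ → ℝ} {u : ℕ → C(Torus, ℂ)} {E : ℕ → ℕ}
    (hE : ∀ n, E n ∈ goodSpectrum) (hlam : ∀ n, lam n ^ 2 = E n) (hlim : Tendsto lam atTop atTop)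
    (hu : ∀ n, IsNormalizedEigenfunction (u n) (lam n)) (j : ℤ × ℤ) :
    Tendsto (fun n => ∫ x, character j x * ((‖u n x‖ ^ 2 : ℝ) : ℂ) ∂ν) atTop
      (𝓝 (∫ x, character j x ∂ν)) := by
  have hElim : Tendsto (fun n => (E n : ℝ)) atTop atTop := by
    simp_rw [← hlam]
    exact (tendsto_pow_atTop two_ne_zero).comp hlim
  have hR : Tendsto (fun n => (E n : ℝ) ^ (1 / 4 : ℝ)) atTop atTop :=
    (tendsto_rpow_atTop (by norm_num)).comp hElim
  have hz : Tendsto (fun n => 2 * B * (E n : ℝ) ^ (-(5 / 96) : ℝ)) atTop (𝓝 0) := by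
    simpa using ((tendsto_rpow_neg_atTop (by norm_num : (0 : ℝ) < 5 / 96)).comp hElim).const_mul (2 * B)
  rw [tendsto_iff_norm_sub_tendsto_zero]
  refine squeeze_zero' (Eventually.of_forall fun n => norm_nonneg _) ?_ hz
  filter_upwards [hR.eventually_ge_atTop 2, hR.eventually_ge_atTop (2 * |(j.1 : ℝ)|),
    hR.eventually_ge_atTop (2 * |(j.2 : ℝ)|), hElim.eventually_gt_atTop 0] with n h2 h0 h1 hpos
  refine (norm_integral_character_sub_le (hu n) (hlam n) j (by positivity) fun k hk l hl hkl =>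
    decay_at_differences hB hdecay (hE n) h2 h0 h1 hk hl hkl).trans ?_
  have hr : ((circlePoints (E n)).card : ℝ) ≤ (E n : ℝ) ^ (1 / 32 : ℝ) := by
    have h3 : ((circlePoints (E n)).card : ℝ) ^ 32 ≤ E n := by exact_mod_cast (hE n).2.2
    calc _ = (((circlePoints (E n)).card : ℝ) ^ 32) ^ (1 / 32 : ℝ) := by
          rw [← Real.rpow_natCast, ← Real.rpow_mul (by positivity)]
          norm_num
      _ ≤ _ := Real.rpow_le_rpow (by positivity) h3 (by norm_num)
  -- The exponents add up to `1/32 - 1/12 = -5/96`, so the few points on the circle do not destroy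
  -- the decay.
  calc _ ≤ (E n : ℝ) ^ (1 / 32 : ℝ) * (2 * B * (E n : ℝ) ^ (-(1 / 12) : ℝ)) := by gcongr
    _ = 2 * B * ((E n : ℝ) ^ (1 / 32 : ℝ) * (E n : ℝ) ^ (-(1 / 12) : ℝ)) := by ring
    _ = _ := by
      rw [← Real.rpow_add hpos]
      norm_num

/-- Weak convergence of `|u n|² ν` may be tested on characters. -/
theorem tendsto_integral_of_character {ν : Measure Torus} [IsFiniteMeasure ν] {u : ℕ → C(Torus, ℂ)}
    (h : ∀ j, Tendsto (fun n => ∫ x, character j x * ((‖u n x‖ ^ 2 : ℝ) : ℂ) ∂ν) atTop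
      (𝓝 (∫ x, character j x ∂ν))) (a : C(Torus, ℂ)) :
    Tendsto (fun n => ∫ x, a x * ((‖u n x‖ ^ 2 : ℝ) : ℂ) ∂ν) atTop (𝓝 (∫ x, a x ∂ν)) := by
  let w : ℕ → C(Torus, ℂ) := fun n => ⟨fun x => ((‖u n x‖ ^ 2 : ℝ) : ℂ), by fun_prop⟩
  have hi : ∀ (b : C(Torus, ℂ)) n, Integrable (fun x => b x * ((‖u n x‖ ^ 2 : ℝ) : ℂ)) ν :=
    fun b n => integrable_mul b (w n)
  -- The trivial character controls the masses of `|u n|² ν`, so uniform approximation of `a` costs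
  -- an error uniform in large `n`.
  have hmass : Tendsto (fun n => ∫ x, ‖u n x‖ ^ 2 ∂ν) atTop (𝓝 (ν.real Set.univ)) := by
    have h0 := (Complex.continuous_re.tendsto _).comp (h 0)
    simp only [character_zero, one_mul, integral_complex_ofReal, Function.comp_def, Complex.ofReal_re,
      integral_const] at h0
    simpa using h0
  have hspan : ∀ b ∈ Submodule.span ℂ (Set.range character),
      Tendsto (fun n => ∫ x, b x * ((‖u n x‖ ^ 2 : ℝ) : ℂ) ∂ν) atTop (𝓝 (∫ x, b x ∂ν)) := by
    intro b hb
    induction hb using Submodule.span_induction with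
    | mem b hb =>
      obtain ⟨j, rfl⟩ := hb
      exact h j
    | zero => simp
    | add b c _ _ hb hc =>
      simp only [ContinuousMap.add_apply, add_mul]
      rw [integral_add (integrable_continuousMap b) (integrable_continuousMap c)]
      refine (hb.add hc).congr fun n => ?_
      rw [integral_add (hi b n) (hi c n)]
    | smul c b _ hb =>
      simp only [ContinuousMap.smul_apply, smul_eq_mul, mul_assoc]
      rw [integral_const_mul]
      refine (hb.const_mul c).congr fun n => ?_
      rw [integral_const_mul]
  rw [Metric.tendsto_atTop']
  intro ε hε
  set V := ν.real Set.univ with hV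
  have hV0 : 0 ≤ V := measureReal_nonneg
  obtain ⟨b, hb, hab⟩ := exists_span_near a (show 0 < ε / (3 * (V + 1)) by positivity)
  have ev1 := (Metric.tendsto_nhds.1 (hspan b hb)) (ε / 3) (by positivity)
  have ev2 := hmass.eventually_le_const (show V < V + 1 by linarith)
  suffices hs : ∀ᶠ n in atTop, dist (∫ x, a x * ((‖u n x‖ ^ 2 : ℝ) : ℂ) ∂ν) (∫ x, a x ∂ν) < ε by
    obtain ⟨N, hN⟩ := eventually_atTop.1 hs
    exact ⟨N, fun n hn => hN n hn.le⟩
  filter_upwards [ev1, ev2] with n h1 h2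
  have hsq : Integrable (fun x => ‖u n x‖ ^ 2) ν := by
    have := (integrable_continuousMap (μ := ν) (w n)).re
    simpa only [w, ContinuousMap.coe_mk, RCLike.re_to_complex, Complex.ofReal_re] using this
  have d1 : dist (∫ x, a x * ((‖u n x‖ ^ 2 : ℝ) : ℂ) ∂ν) (∫ x, b x * ((‖u n x‖ ^ 2 : ℝ) : ℂ) ∂ν) ≤ ε / 3 := by
    rw [dist_eq_norm, ← integral_sub (hi a n) (hi b n)]
    calc _ ≤ ∫ x, ‖a - b‖ * ‖u n x‖ ^ 2 ∂ν := by
          refine norm_integral_le_of_norm_le (hsq.const_mul _) (Eventually.of_forall fun x => ?_)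
          rw [← sub_mul, norm_mul, Complex.norm_real, Real.norm_eq_abs, abs_of_nonneg (by positivity)]
          exact mul_le_mul_of_nonneg_right ((a - b).norm_coe_le_norm x) (by positivity)
      _ = ‖a - b‖ * ∫ x, ‖u n x‖ ^ 2 ∂ν := integral_const_mul _ _
      _ ≤ ε / (3 * (V + 1)) * (V + 1) :=
          mul_le_mul hab.le h2 (integral_nonneg fun x => by positivity) (by positivity)
      _ = ε / 3 := by field_simp
  have d2 : dist (∫ x, b x ∂ν) (∫ x, a x ∂ν) < ε / 3 := by
    rw [dist_eq_norm, ← integral_sub (integrable_continuousMap b) (integrable_continuousMap a)]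
    have := norm_integral_le_of_norm_le_const (μ := ν) (C := ε / (3 * (V + 1)))
      (f := fun x => b x - a x) (Eventually.of_forall fun x => by
        rw [norm_sub_rev]
        exact ((a - b).norm_coe_le_norm x).trans hab.le)
    refine this.trans_lt ?_
    rw [← hV, div_mul_eq_mul_div, div_lt_div_iff₀ (by positivity) (by norm_num)]
    nlinarith
  calc _ ≤ _ := dist_triangle4 _ (∫ x, b x * ((‖u n x‖ ^ 2 : ℝ) : ℂ) ∂ν) (∫ x, b x ∂ν) _
    _ < ε := by linarith

end TorusQUE

end

theorem proposition4p3 (C : TorusQUE.ClosedCurve) (hC : ∀ i t, C.curvature i t ≠ 0) :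
    ∃ S : Set ℕ, TorusQUE.IsDensityOneSubset S TorusQUE.laplaceSpectrum ∧
      ∀ (lam : ℕ → ℝ) (ψ : ℕ → TorusQUE.Torus → ℂ),
        (∀ n, ∃ E ∈ S, lam n ^ 2 = (E : ℝ)) →
        Tendsto lam atTop atTop →
        (∀ n, TorusQUE.IsNormalizedEigenfunction (ψ n) (lam n)) →
        ∀ a : C(TorusQUE.Torus, ℂ),
          Tendsto (fun n => ∫ x, a x * ((‖ψ n x‖ ^ 2 : ℝ) : ℂ) ∂C.arcLength) atTop
            (𝓝 (∫ x, a x ∂C.arcLength)) := by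
  obtain ⟨B, hB, hdecay⟩ := C.exists_fourier_decay hC
  -- The density one set does not depend on the curve; only the constant `B` does.
  refine ⟨TorusQUE.goodSpectrum, TorusQUE.isDensityOneSubset_goodSpectrum, ?_⟩
  intro lam ψ hE hlim hψ a
  choose E hE hlam using hE
  choose u hu using fun n => (hψ n).exists_continuousMap
  obtain rfl : ψ = fun n => ⇑(u n) := funext fun n => (hu n).symm
  exact TorusQUE.tendsto_integral_of_character
    (fun j => TorusQUE.tendsto_integral_character hB hdecay hE hlam hlim hψ j) a
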